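/- **Setting.** Fix a sampling period $t>0$, a real $\beta>1$, a gain $\alpha\in(-\beta^{-1},0)$, a threshold $U>0$, and let $A=\begin{bmatrix}I&tI\\0&I\end{bmatrix}$, $B=\begin{bmatrix}\frac12t^2I\\tI\end{bmatrix}$ ($I=I_3$). Two guardians with states $X_i=(p_i,v_i)\in\mathbb R^6$ and a hostile target with state $\bar X_2=(\bar p_2,\bar v_2)\in\mathbb R^6$ move by $$X_i(k+1)=AX_i(k)+Bu_i(k)\ (i=1,2),\qquad \bar X_2(k+1)=A\bar X_2(k)+B\bar u_2(k),\qquad k=0,1,2,\dots$$ The random acceleration $\bar u_2(k)$ has the mixture law $\gamma\,\mathcal N(0,W_{1,2})+(1-\gamma)\,\mathcal N(0,W_{2,2})$ with $\gamma\in(0,1]$ and $\hat w_iI\le W_{i,2}\le\check w_iI$, $\hat w_i>0$; put $W_2=\gamma W_{1,2}+(1-\gamma)W_{2,2}$ and $\check c_W=\gamma\check w_1+(1-\gamma)\check w_2$. The guardians measure $\|p_i(k)-\bar p_2(k)\|^2+\eta_i(k)$, $k\ge1$, with $\eta_i(k)\sim\mathcal N(0,\sigma_i)$, where $\sigma_i>0$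 is the variance; put $\Gamma_2=\frac14(\sigma_1+\sigma_2)$. Let $(\mathcal F_k)$ be a filtration such that $\bar u_2(k),\eta_1(k+1),\eta_2(k+1)$ are $\mathcal F_{k+1}$-measurable, mutually independent, and jointly independent of $\mathcal F_k$. With $q_{12}=p_1-p_2$, $C(k)=[q_{12}(k)^\top\ 0]$ and $Y(k)=-\frac12\big(m_1-m_2-\|p_1\|^2+\|p_2\|^2\big)(k)$, where $m_i$ is the measured squared distance of guardian $i$, the estimate $\hat{\bar X}_2=(\hat{\bar p}_2,\hat{\bar v}_2)$ is given by the Kalman filter $$\hat{\bar X}_2(k)=A\hat{\bar X}_2(k-1)+K(k)\big[Y(k)-C(k)A\hat{\bar X}_2(k-1)\big],\quad K(k)=G(k|k-1)C(k)^\top\big[C(k)G(k|k-1)C(k)^\top+\Gamma_2\big]^{-1},$$ $$G(k|k-1)=AG(k-1)A^\top+BW_2B^\top,\qquad G(k)=(I-K(k)C(k))\,G(k|k-1).$$ The initial data $X_i(0),\bar X_2(0),\hat{\bar X}_2(0),G(0)$ are $\mathcal F_0$-measurable with $\|q_{12}(0)\|\le R$ and $\hat gI\le G(0)\le\check gI$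 for constants $R$, $\hat g>0$, $\check g$, and the errors $e(k)=\bar X_2(k)-\hat{\bar X}_2(k)$ and $\bar e_2(k)=q_1^2(k)+q_2^2(k)$, where $q_i^2=p_i-\bar p_2$, are square integrable at $k=0$. The shape vector is $\zeta(k)=r(k)\,[\sin(\rho k\pi),\cos(\rho k\pi),\mathrm h(k)]^\top$, with $\rho\in\mathbb R$, a deterministic $\mathrm h:\mathbb N\to\mathbb R$ and a radius $r$ such that $r(0)$ is $\mathcal F_0$-measurable and $r(k+1)$ is $\mathcal F_k$-measurable. It is bounded, $\|\zeta(k)\|\le\bar r$, and persistently exciting: there are $\hat a_\zeta>0$, $\check a_\zeta$ and $N$ with $\hat a_\zeta I\le\sum_{m=k}^{k+N-1}\zeta(m)\zeta(m)^\top\le\check a_\zeta I$ for all $k\ge0$. Let $\tau\in\{0,1,2,\dots\}\cup\{\infty\}$ be a stopping time, and suppose that at all steps $k<\tau$ the hostile-target control law $$u_i=\frac2{t^2}\Big[(\alpha-1)\,\mathbf g\,(p_i-\hat{\bar p}_2)+(-1)^i\big(\zeta(k+1)-\alpha\zeta(k)\big)\Big]+\frac2t(\hat{\bar v}_2-v_i),\qquad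 \mathbf g=\frac1\beta\Big(\frac{U(\beta-1)}{\max\{U,\frac12(\|p_1-\hat{\bar p}_2\|+\|p_2-\hat{\bar p}_2\|)\}}+1\Big)$$ is in force. (For example $\tau=\infty$; or $\tau$ is the first step at which the estimated distance between the protected and the hostile target leaves the union of the warning zone, where $r$ is constant, and the take-down zone, where $r$ decreases linearly.) **Theorem.** There are constants $\kappa,b>0$ and $\theta\in(0,1)$, depending only on the parameters ($t,\alpha,\beta,U,\rho,\mathrm h,\bar r,N,\hat a_\zeta,\check a_\zeta,\gamma,W_{i,2},\hat w_i,\check w_i,\sigma_i,R,\hat g,\check g$), with the following property. Let $\varrho\in(0,1)$ satisfy $\frac{\sqrt{1+\varrho}}{\sqrt{1+\varrho}-1}>\beta>\sqrt{1+\varrho}$, and put $\tilde\beta^{-1}=\max\{\beta^{-1},1-\beta^{-1}\}$ and $$\Phi(\varepsilon)=4(1+\varrho^{-1})\big((1-\alpha)^2+t^2\big)\varepsilon+3t^4\check c_W .$$ Then $(1+\varrho)\tilde\beta^{-2}<1$, and there are $D>0$ and $\nu\in(0,1)$, depending only on the parameters and $\varrho$, such that in every such closed loop and for every $k\ge0$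 the expectations below are finite and: 1. the estimation error satisfies $\mathbf E\big[\|e(k)\|^2\mathbf 1_{\{k\le\tau\}}\big]\le\kappa\,\theta^k\,\mathbf E\|e(0)\|^2+b$, hence it is bounded by $\hat\varepsilon=\kappa\,\mathbf E\|e(0)\|^2+b$; 2. the encirclement error $\bar e_2=q_1^2+q_2^2$ satisfies $$\mathbf E\big[\|\bar e_2(k)\|^2\mathbf 1_{\{k\le\tau\}}\big]\le\varepsilon_2(k):=\big((1+\varrho)\tilde\beta^{-2}\big)^k\,\mathbf E\|\bar e_2(0)\|^2+\sum_{\imath=0}^{k-1}\big((1+\varrho)\tilde\beta^{-2}\big)^{\imath}\,\Phi(\hat\varepsilon);$$ 3. it converges exponentially to a region that does not depend on the initial errors: $$\mathbf E\big[\|\bar e_2(k)\|^2\mathbf 1_{\{k\le\tau\}}\big]\le D\,\nu^k\big(\mathbf E\|\bar e_2(0)\|^2+\mathbf E\|e(0)\|^2\big)+\frac{\Phi(b)}{1-(1+\varrho)\tilde\beta^{-2}}.$$ -/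

import Mathlib

open MeasureTheory ProbabilityTheory

noncomputable section

namespace Encirclement

/-! ### Kinematics -/

/-- Vectors of `ℝ³` with the Euclidean norm (positions, velocities, accelerations). -/
abbrev Vec3 := EuclideanSpace ℝ (Fin 3)

/-- Indices of the six coordinates of a state: position coordinates, then velocity coordinates. -/
abbrev StateIdx := Fin 3 ⊕ Fin 3

/-- States (position, velocity) in `ℝ⁶` with the Euclidean norm. -/
abbrev State := EuclideanSpace ℝ StateIdx

/-- Position component of a state. -/
def pos (X : State) : Vec3 := WithLp.toLp 2 fun i => X (Sum.inl i)

/-- Velocity component of a state. -/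
def vel (X : State) : Vec3 := WithLp.toLp 2 fun i => X (Sum.inr i)

/-- The system matrix `A = [[I, tI], [0, I]]`. -/
def matA (t : ℝ) : Matrix StateIdx StateIdx ℝ :=
  Matrix.fromBlocks 1 (t • (1 : Matrix (Fin 3) (Fin 3) ℝ)) 0 1

/-- The input matrix `B = [[(t²/2) I], [t I]]`. -/
def matB (t : ℝ) : Matrix StateIdx (Fin 3) ℝ :=
  Matrix.fromRows ((t ^ 2 / 2) • (1 : Matrix (Fin 3) (Fin 3) ℝ))
    (t • (1 : Matrix (Fin 3) (Fin 3) ℝ))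

/-- One step `A X + B u` of the motion model shared by guardians and targets. -/
def motion (t : ℝ) (X : State) (u : Vec3) : State :=
  Matrix.toEuclideanLin (matA t) X + Matrix.toEuclideanLin (matB t) u

/-! ### Encirclement shape and control law -/

/-- The encirclement shape vector `r (sin(ρkπ), cos(ρkπ), h(k))` at step `k` for the radius `r`. -/
def shape (ρ : ℝ) (h : ℕ → ℝ) (r : ℝ) (k : ℕ) : Vec3 :=
  r • !₂[Real.sin (ρ * k * Real.pi), Real.cos (ρ * k * Real.pi), h k]

/-- The saturation function `g(d₁, d₂) = (1/β) (U(β-1) / max{U, (d₁+d₂)/2} + 1)`. -/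
def satur (β U d₁ d₂ : ℝ) : ℝ :=
  1 / β * (U * (β - 1) / max U ((d₁ + d₂) / 2) + 1)

/-- The control input
`u = (2/t²) [(α-1) g (p - p̂) + s (ζ⁺ - α ζ)] + (2/t) (v̂ - v)`
of a guardian with state `X`, sign `s = ±1` and saturation value `g`, for the estimated target
state `Xhat`, the current shape vector `ζ` and the next shape vector `ζ⁺`. -/
def ctrlInput (t α s g : ℝ) (X Xhat : State) (ζ ζnext : Vec3) : Vec3 :=
  (2 / t ^ 2) • (((α - 1) * g) • (pos X - pos Xhat) + s • (ζnext - α • ζ))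
    + (2 / t) • (vel Xhat - vel X)

/-- The sign `(-1)^i` for guardians `i = 1, 2`, which are indexed here by `0, 1 : Fin 2`. -/
def guardSign (i : Fin 2) : ℝ := (-1) ^ (i.val + 1)

/-! ### Kalman filter -/

/-- The output row `C = [q₁₂ᵀ 0]`. -/
def outRow (q : Vec3) : StateIdx → ℝ := Sum.elim (fun i => q i) (fun _ => 0)

/-- The predicted covariance `A G Aᵀ + B W Bᵀ`. -/
def predCov (t : ℝ) (W : Matrix (Fin 3) (Fin 3) ℝ) (G : Matrix StateIdx StateIdx ℝ) :
    Matrix StateIdx StateIdx ℝ :=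
  matA t * G * (matA t).transpose + matB t * W * (matB t).transpose

/-- The gain `H Cᵀ (C H Cᵀ + Γ)⁻¹` for the predicted covariance `H`, output row `C` and the
(scalar) output noise variance `Γ`. -/
def kalmanGain (Γ : ℝ) (H : Matrix StateIdx StateIdx ℝ) (C : StateIdx → ℝ) : StateIdx → ℝ :=
  (C ⬝ᵥ H.mulVec C + Γ)⁻¹ • H.mulVec C

/-- The updated covariance `(I - K C) H`. -/
def updCov (H : Matrix StateIdx StateIdx ℝ) (K C : StateIdx → ℝ) : Matrix StateIdx StateIdx ℝ :=
  (1 - Matrix.vecMulVec K C) * H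

/-- The linear output `Y = -(1/2) (m₁ - m₂ - p₁ᵀp₁ + p₂ᵀp₂)` built from the measured squared
distances `m₁, m₂` and the guardian positions. -/
def linOutput (m₁ m₂ : ℝ) (p₁ p₂ : Vec3) : ℝ :=
  -(1 / 2) * (m₁ - m₂ - ‖p₁‖ ^ 2 + ‖p₂‖ ^ 2)

/-! ### Noise -/

/-- The Gaussian mixture `γ N(0, W₁) + (1-γ) N(0, W₂)`. -/
def mixtureLaw (γ : ℝ) (W₁ W₂ : Matrix (Fin 3) (Fin 3) ℝ) : Measure Vec3 :=
  ENNReal.ofReal γ • multivariateGaussian 0 W₁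
    + ENNReal.ofReal (1 - γ) • multivariateGaussian 0 W₂

/-! ### Parameters -/

/-- The numerical data of the problem. -/
structure Params where
  /-- sampling period -/
  t : ℝ
  /-- controller gain -/
  α : ℝ
  /-- saturation parameter -/
  β : ℝ
  /-- saturation threshold -/
  U : ℝ
  /-- encirclement frequency -/
  ρ : ℝ
  /-- vertical motion function -/
  h : ℕ → ℝ
  /-- bound on the shape vectors -/
  rbar : ℝ
  /-- window length and lower and upper constants of the persistent excitation of the shape -/
  N : ℕ
  alo : ℝ
  ahi : ℝ
  /-- mixing probability and the two covariances of the acceleration of the hostile target -/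
  γ : ℝ
  W : Fin 2 → Matrix (Fin 3) (Fin 3) ℝ
  /-- lower and upper bounds of the two covariances -/
  wlo : Fin 2 → ℝ
  whi : Fin 2 → ℝ
  /-- variances of the two squared-distance noises -/
  σ : Fin 2 → NNReal
  /-- bound on the initial distance between the guardians -/
  R : ℝ
  /-- lower and upper bounds of the initial filter covariance -/
  glo : ℝ
  ghi : ℝ

namespace Params

/-- Standing assumptions on the numerical data. -/
structure Admissible (c : Params) : Prop where
  t_pos : 0 < c.t
  β_gt : 1 < c.β
  α_gt : -c.β⁻¹ < c.α
  α_neg : c.α < 0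
  U_pos : 0 < c.U
  alo_pos : 0 < c.alo
  γ_pos : 0 < c.γ
  γ_le : c.γ ≤ 1
  wlo_pos : ∀ i, 0 < c.wlo i
  W_lower : ∀ i, (c.W i - c.wlo i • (1 : Matrix (Fin 3) (Fin 3) ℝ)).PosSemidef
  W_upper : ∀ i, (c.whi i • (1 : Matrix (Fin 3) (Fin 3) ℝ) - c.W i).PosSemidef
  σ_pos : ∀ i, 0 < c.σ i
  glo_pos : 0 < c.glo

/-- The covariance `W₂ = γ W₁₂ + (1-γ) W₂₂` of the acceleration of the hostile target. -/
def accCov (c : Params) : Matrix (Fin 3) (Fin 3) ℝ := c.γ • c.W 0 + (1 - c.γ) • c.W 1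

/-- The upper bound `γ w̌₁ + (1-γ) w̌₂` of `W₂`. -/
def accCovUpper (c : Params) : ℝ := c.γ * c.whi 0 + (1 - c.γ) * c.whi 1

/-- The output noise variance `Γ₂ = (σ₁ + σ₂)/4`. -/
def outVar (c : Params) : ℝ := (c.σ 0 + c.σ 1) / 4

/-- The contraction bound `β̃⁻¹ = max{β⁻¹, 1 - β⁻¹}`. -/
def contr (c : Params) : ℝ := max c.β⁻¹ (1 - c.β⁻¹)

/-- The decay rate `(1+ϱ) β̃⁻²`. -/
def rate (c : Params) (ϱ : ℝ) : ℝ := (1 + ϱ) * c.contr ^ 2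

/-- The constant forcing `4(1+ϱ⁻¹)((1-α)²+t²) ε + 3 t⁴ č` of the mean square recursion, where `ε`
bounds the mean square estimation error and `č` bounds the acceleration covariance. -/
def forcing (c : Params) (ϱ ε : ℝ) : ℝ :=
  4 * (1 + ϱ⁻¹) * ((1 - c.α) ^ 2 + c.t ^ 2) * ε + 3 * c.t ^ 4 * c.accCovUpper

end Params

/-! ### The closed loop -/

/-- The processes of the closed loop; time steps are `k = 0, 1, 2, …`. -/
structure Processes (Ω : Type*) where
  /-- states of the two guardians -/
  X : Fin 2 → ℕ → Ω → State
  /-- control inputs of the two guardians -/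
  u : Fin 2 → ℕ → Ω → Vec3
  /-- state of the hostile target -/
  T : ℕ → Ω → State
  /-- acceleration of the hostile target -/
  a : ℕ → Ω → Vec3
  /-- noises of the two squared-distance measurements -/
  η : Fin 2 → ℕ → Ω → ℝ
  /-- estimate of the state of the hostile target -/
  That : ℕ → Ω → State
  /-- filter covariance -/
  G : ℕ → Ω → Matrix StateIdx StateIdx ℝ
  /-- encirclement radius -/
  r : ℕ → Ω → ℝ

namespace Processes

variable {Ω : Type*} (S : Processes Ω)

/-- Relative position `q₁₂` of the guardians. -/
def q₁₂ (k : ℕ) (ω : Ω) : Vec3 := pos (S.X 0 k ω) - pos (S.X 1 k ω)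

/-- The measured squared distance `‖pᵢ - p̄₂‖² + ηᵢ`. -/
def meas (i : Fin 2) (k : ℕ) (ω : Ω) : ℝ :=
  ‖pos (S.X i k ω) - pos (S.T k ω)‖ ^ 2 + S.η i k ω

/-- The output `Y(k)`. -/
def output (k : ℕ) (ω : Ω) : ℝ :=
  linOutput (S.meas 0 k ω) (S.meas 1 k ω) (pos (S.X 0 k ω)) (pos (S.X 1 k ω))

/-- The saturation value `g²(k)`, from the estimated distances `‖pᵢ - p̂₂‖`. -/
def saturVal (c : Params) (k : ℕ) (ω : Ω) : ℝ :=
  satur c.β c.U ‖pos (S.X 0 k ω) - pos (S.That k ω)‖ ‖pos (S.X 1 k ω) - pos (S.That k ω)‖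

/-- The shape vector `ζ(k)`. -/
def ζ (c : Params) (k : ℕ) (ω : Ω) : Vec3 := shape c.ρ c.h (S.r k ω) k

/-- The predicted covariance `G(k+1|k)`. -/
def Gpred (c : Params) (k : ℕ) (ω : Ω) : Matrix StateIdx StateIdx ℝ :=
  predCov c.t c.accCov (S.G k ω)

/-- The estimator gain `K(k+1)`. -/
def gain (c : Params) (k : ℕ) (ω : Ω) : StateIdx → ℝ :=
  kalmanGain c.outVar (S.Gpred c k ω) (outRow (S.q₁₂ (k + 1) ω))

/-- The estimation error of the hostile target. -/
def estErr (k : ℕ) (ω : Ω) : State := S.T k ω - S.That k ω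

/-- The anti-synchronization encirclement error `q₁² + q₂²` of the hostile target. -/
def encErr (k : ℕ) (ω : Ω) : Vec3 :=
  (pos (S.X 0 k ω) - pos (S.T k ω)) + (pos (S.X 1 k ω) - pos (S.T k ω))

end Processes

/-- `S` is a closed loop in which the hostile-target control law is in force at all steps
`k < τ`. Here `ℱ k` is the information up to step `k`, and `τ` (possibly `∞`) is a stopping time,
for instance the first step at which the estimated distance between the targets leaves the
union of the warning zone and the take-down zone, or the capture step. In both zones the control
law is the same formula; they differ in the radius only (constant, respectively linearly
decreasing), which is an arbitrary process here, known one step ahead, with a bounded and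
persistently exciting shape. Nothing is required of the controls from step `τ` on. -/
structure IsHostilePhase (c : Params) {Ω : Type*} [MeasurableSpace Ω] (P : Measure Ω)
    (ℱ : Filtration ℕ ‹MeasurableSpace Ω›) (τ : Ω → WithTop ℕ) (S : Processes Ω) : Prop where
  stopping : IsStoppingTime ℱ τ
  /- initial data -/
  X_init : ∀ i, Measurable[ℱ 0] (S.X i 0)
  T_init : Measurable[ℱ 0] (S.T 0)
  That_init : Measurable[ℱ 0] (S.That 0)
  G_init : ∀ a b, Measurable[ℱ 0] fun ω => S.G 0 ω a b
  q_init : ∀ ω, ‖S.q₁₂ 0 ω‖ ≤ c.R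
  estErr_init : MemLp (S.estErr 0) 2 P
  encErr_init : MemLp (S.encErr 0) 2 P
  G_lower : ∀ ω, (S.G 0 ω - c.glo • (1 : Matrix StateIdx StateIdx ℝ)).PosSemidef
  G_upper : ∀ ω, (c.ghi • (1 : Matrix StateIdx StateIdx ℝ) - S.G 0 ω).PosSemidef
  /- noises: `a(k)` and `η(k+1)` become known at step `k+1` and do not depend on the past -/
  a_meas : ∀ k, Measurable[ℱ (k + 1)] (S.a k)
  η_meas : ∀ i k, Measurable[ℱ (k + 1)] (S.η i (k + 1))
  a_law : ∀ k, P.map (S.a k) = mixtureLaw c.γ (c.W 0) (c.W 1)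
  η_law : ∀ i k, P.map (S.η i (k + 1)) = gaussianReal 0 (c.σ i)
  noise_indep_past : ∀ k,
    Indep (MeasurableSpace.comap (fun ω => (S.a k ω, S.η 0 (k + 1) ω, S.η 1 (k + 1) ω))
      inferInstance) (ℱ k) P
  a_indep_η : ∀ k, IndepFun (S.a k) (fun ω => (S.η 0 (k + 1) ω, S.η 1 (k + 1) ω)) P
  η_indep : ∀ k, IndepFun (S.η 0 (k + 1)) (S.η 1 (k + 1)) P
  /- radius and shape: the radius of step `k+1` enters the control of step `k` -/
  r_init : Measurable[ℱ 0] (S.r 0)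
  r_meas : ∀ k, Measurable[ℱ k] (S.r (k + 1))
  ζ_bound : ∀ k ω, ‖S.ζ c k ω‖ ≤ c.rbar
  ζ_lower : ∀ k ω, ((∑ m ∈ Finset.Ico k (k + c.N),
      Matrix.vecMulVec (S.ζ c m ω).ofLp (S.ζ c m ω).ofLp)
    - c.alo • (1 : Matrix (Fin 3) (Fin 3) ℝ)).PosSemidef
  ζ_upper : ∀ k ω, (c.ahi • (1 : Matrix (Fin 3) (Fin 3) ℝ)
    - ∑ m ∈ Finset.Ico k (k + c.N),
      Matrix.vecMulVec (S.ζ c m ω).ofLp (S.ζ c m ω).ofLp).PosSemidef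
  /- motion of the target and of the guardians -/
  T_step : ∀ k ω, S.T (k + 1) ω = motion c.t (S.T k ω) (S.a k ω)
  X_step : ∀ i k ω, S.X i (k + 1) ω = motion c.t (S.X i k ω) (S.u i k ω)
  /- Kalman filter -/
  That_step : ∀ k ω, S.That (k + 1) ω = Matrix.toEuclideanLin (matA c.t) (S.That k ω)
    + (S.output (k + 1) ω - outRow (S.q₁₂ (k + 1) ω) ⬝ᵥ (matA c.t).mulVec (S.That k ω).ofLp)
      • WithLp.toLp 2 (S.gain c k ω)
  G_step : ∀ k ω, S.G (k + 1) ω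
    = updCov (S.Gpred c k ω) (S.gain c k ω) (outRow (S.q₁₂ (k + 1) ω))
  /- control law, in force before `τ` -/
  u_law : ∀ i (k : ℕ) ω, (k : WithTop ℕ) < τ ω →
    S.u i k ω = ctrlInput c.t c.α (guardSign i) (S.saturVal c k ω) (S.X i k ω) (S.That k ω)
      (S.ζ c k ω) (S.ζ c (k + 1) ω)

end Encirclement

end

/-!
The estimation error is bounded one outcome at a time, and probability enters only through second
moments of the noises. Before the stopping time the control law turns the relative position `q` of
the guardians into a contraction driven by the shape, `q⁺ = λ q - 2 (ζ⁺ - α ζ)` with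
`|λ| ≤ β̃⁻¹ < 1`. Whatever the factors `λ` are, if `q` is nearly orthogonal to a fixed direction `y`
along a window, then `y · ζ` decays like `α ^ i` there, against the persistent excitation of `ζ`
(`exists_norm_le_of_inner_le`). Comparing two windows that are far apart in time also determines
the velocity, so the pair `(A, C(k))` is uniformly observable, robustly with respect to
disturbances (`exists_observability`).

The filter is studied through its adjoint `y ↦ Aᵀ (I - K C)ᵀ y`, which avoids inverse matrices. Its
energy balance (`dotProduct_covStep`) writes `y · G(k+1) y` as the previous covariance at the
adjoint image of `y` plus noise terms. The vectors `G(k) y(k)`, with `y` running through the adjoint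
filter, form a trajectory whose disturbances and outputs are controlled by `y · G y`; observability
then gives `‖G y‖² ≤ g (y · G y)`, hence `G(k) ≤ g I` for all `k` (`exists_covariance_le`).
Since `(A, B)` is controllable in two steps, `G` gains at least `δ I` over two steps
(`exists_two_step_gain`). Together these facts make `sup_y (y · e)² / (y · G y)` contract by a fixed
factor over two steps, up to noise (`sq_dotProduct_errStep_errStep_le`). Iterating, and taking the
mean over the event `k ≤ τ`, gives the bound of the estimation error (`exists_integral_estErr_le`).

The encirclement error satisfies `ē⁺ = λ ē + d - t² a`, where `d` is linear in the estimation error.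
The acceleration `a` is uncorrelated with the rest, so the mean square obeys a scalar recursion with
rate `(1 + ϱ) β̃⁻²` (`IsHostilePhase.integral_encErr_succ_le`). Its solution is compared with a
geometric sum, and with `D ν ^ k` for any `ν` above both decay rates. The controls are unrestricted
after `τ`, so the processes need not be measurable there; up to `τ` they agree with adapted ones
(`IsHostilePhase.exists_adapted`).
-/

noncomputable section

namespace Encirclement

open Matrix

/-! ### Quadratic forms -/

/-- Symmetry and positive semidefiniteness of a real matrix, phrased through its bilinear form. -/
def IsSymmNonneg {ι : Type*} [Fintype ι] (G : Matrix ι ι ℝ) : Prop :=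
  (∀ u y : ι → ℝ, u ⬝ᵥ G *ᵥ y = y ⬝ᵥ G *ᵥ u) ∧ ∀ y : ι → ℝ, 0 ≤ y ⬝ᵥ G *ᵥ y

section Quadratic

variable {ι : Type*} [Fintype ι]

lemma isSymmNonneg_of_posSemidef {G : Matrix ι ι ℝ} (hG : G.PosSemidef) : IsSymmNonneg G := by
  refine ⟨fun u y => ?_, fun y => by simpa using hG.dotProduct_mulVec_nonneg y⟩
  have h : Gᵀ = G := by simpa using hG.isHermitian.eq
  rw [dotProduct_mulVec, ← mulVec_transpose, h, dotProduct_comm]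

lemma sq_dotProduct_le (u v : ι → ℝ) : (u ⬝ᵥ v) ^ 2 ≤ (u ⬝ᵥ u) * (v ⬝ᵥ v) := by
  simpa [dotProduct, sq] using Finset.sum_mul_sq_le_sq_mul_sq Finset.univ u v

lemma dotProduct_self_nonneg' (u : ι → ℝ) : 0 ≤ u ⬝ᵥ u :=
  Finset.sum_nonneg fun i _ => mul_self_nonneg (u i)

lemma dotProduct_self_add_le (u v : ι → ℝ) :
    (u + v) ⬝ᵥ (u + v) ≤ 2 * (u ⬝ᵥ u) + 2 * (v ⬝ᵥ v) := by
  have := dotProduct_self_nonneg' (u - v)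
  simp only [dotProduct_add, add_dotProduct, dotProduct_sub, sub_dotProduct,
    dotProduct_comm v u] at this ⊢
  linarith

/-- Cauchy-Schwarz for a positive semidefinite form. -/
lemma IsSymmNonneg.sq_le {G : Matrix ι ι ℝ} (hG : IsSymmNonneg G) (u v : ι → ℝ) :
    (u ⬝ᵥ G *ᵥ v) ^ 2 ≤ (u ⬝ᵥ G *ᵥ u) * (v ⬝ᵥ G *ᵥ v) := by
  have h : ∀ s : ℝ, 0 ≤ (v ⬝ᵥ G *ᵥ v) * (s * s) + (2 * (u ⬝ᵥ G *ᵥ v)) * s + u ⬝ᵥ G *ᵥ u := by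
    intro s
    have h1 := hG.2 (u + s • v)
    simp only [mulVec_add, mulVec_smul, dotProduct_add, add_dotProduct, dotProduct_smul,
      smul_dotProduct, smul_eq_mul, hG.1 v u] at h1
    linarith
  have := discrim_le_zero h
  rw [discrim] at this
  linarith

/-- If `0 ≤ W ≤ w I` then `W² ≤ w W`. -/
lemma IsSymmNonneg.mulVec_self_le {W : Matrix ι ι ℝ} {w : ℝ} (hW : IsSymmNonneg W)
    (hw : ∀ y : ι → ℝ, y ⬝ᵥ W *ᵥ y ≤ w * (y ⬝ᵥ y)) (y : ι → ℝ) :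
    W *ᵥ y ⬝ᵥ W *ᵥ y ≤ w * (y ⬝ᵥ W *ᵥ y) := by
  have h1 := hW.sq_le (W *ᵥ y) y
  have h2 := hw (W *ᵥ y)
  have h4 := dotProduct_self_nonneg' (W *ᵥ y)
  rcases h4.eq_or_lt with h0 | h0
  · rw [← h0]
    have : W *ᵥ y = 0 := by simpa using h0.symm
    simp [this]
  · have h5 : (W *ᵥ y ⬝ᵥ W *ᵥ y) * (W *ᵥ y ⬝ᵥ W *ᵥ y)
        ≤ (W *ᵥ y ⬝ᵥ W *ᵥ y) * (w * (y ⬝ᵥ W *ᵥ y)) := by nlinarith [hW.2 y]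
    exact le_of_mul_le_mul_left h5 h0

end Quadratic

/-! ### One step of the Kalman filter, seen from the adjoint system -/

/-- The adjoint measurement update: for the gain `K` of the predicted covariance `H`, it maps `y`
to `(I - K C)ᵀ y = y - (K·y) Cᵀ`. -/
def adjUpd (Γ : ℝ) (H : Matrix StateIdx StateIdx ℝ) (C y : StateIdx → ℝ) : StateIdx → ℝ :=
  y - (kalmanGain Γ H C ⬝ᵥ y) • C

section Update

variable {Γ : ℝ} {H : Matrix StateIdx StateIdx ℝ}

lemma innovVar_pos (hΓ : 0 < Γ) (hH : IsSymmNonneg H) (C : StateIdx → ℝ) :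
    0 < C ⬝ᵥ H *ᵥ C + Γ := by
  have := hH.2 C
  linarith

lemma innovVar_mul_gain (hΓ : 0 < Γ) (hH : IsSymmNonneg H) (C : StateIdx → ℝ) :
    (C ⬝ᵥ H *ᵥ C + Γ) • kalmanGain Γ H C = H *ᵥ C := by
  rw [kalmanGain, smul_smul, mul_inv_cancel₀ (innovVar_pos hΓ hH C).ne', one_smul]

lemma dotProduct_mulVec_eq_gain (hΓ : 0 < Γ) (hH : IsSymmNonneg H) (C y : StateIdx → ℝ) :
    C ⬝ᵥ H *ᵥ y = (C ⬝ᵥ H *ᵥ C + Γ) * (kalmanGain Γ H C ⬝ᵥ y) := by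
  rw [hH.1, ← innovVar_mul_gain hΓ hH C, dotProduct_smul, smul_eq_mul, dotProduct_comm y,
    innovVar_mul_gain hΓ hH C]

lemma updCov_mulVec (hΓ : 0 < Γ) (hH : IsSymmNonneg H) (C y : StateIdx → ℝ) :
    updCov H (kalmanGain Γ H C) C *ᵥ y = H *ᵥ adjUpd Γ H C y := by
  have h1 : updCov H (kalmanGain Γ H C) C *ᵥ y
      = H *ᵥ y - (C ⬝ᵥ H *ᵥ y) • kalmanGain Γ H C := by
    rw [updCov, ← mulVec_mulVec, sub_mulVec, one_mulVec, vecMulVec_mulVec]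
    simp
  rw [h1, adjUpd, mulVec_sub, mulVec_smul, dotProduct_mulVec_eq_gain hΓ hH,
    ← innovVar_mul_gain hΓ hH C, smul_smul, mul_comm, innovVar_mul_gain hΓ hH C]

lemma outRow_dotProduct_updCov (hΓ : 0 < Γ) (hH : IsSymmNonneg H) (C y : StateIdx → ℝ) :
    C ⬝ᵥ updCov H (kalmanGain Γ H C) C *ᵥ y = Γ * (kalmanGain Γ H C ⬝ᵥ y) := by
  rw [updCov_mulVec hΓ hH, adjUpd, mulVec_sub, mulVec_smul, dotProduct_sub, dotProduct_smul,
    dotProduct_mulVec_eq_gain hΓ hH C y, smul_eq_mul]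
  ring

lemma dotProduct_updCov_mulVec (hΓ : 0 < Γ) (hH : IsSymmNonneg H) (C u y : StateIdx → ℝ) :
    u ⬝ᵥ updCov H (kalmanGain Γ H C) C *ᵥ y
      = adjUpd Γ H C u ⬝ᵥ H *ᵥ adjUpd Γ H C y
        + Γ * ((kalmanGain Γ H C ⬝ᵥ u) * (kalmanGain Γ H C ⬝ᵥ y)) := by
  have h1 : u = adjUpd Γ H C u + (kalmanGain Γ H C ⬝ᵥ u) • C := by simp [adjUpd]
  have h2 := outRow_dotProduct_updCov hΓ hH C y
  rw [updCov_mulVec hΓ hH] at h2 ⊢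
  conv_lhs => rw [h1]
  rw [add_dotProduct, smul_dotProduct, h2, smul_eq_mul]
  ring

lemma isSymmNonneg_updCov (hΓ : 0 < Γ) (hH : IsSymmNonneg H) (C : StateIdx → ℝ) :
    IsSymmNonneg (updCov H (kalmanGain Γ H C) C) := by
  refine ⟨fun u y => ?_, fun y => ?_⟩
  · rw [dotProduct_updCov_mulVec hΓ hH, dotProduct_updCov_mulVec hΓ hH, hH.1]
    ring
  · rw [dotProduct_updCov_mulVec hΓ hH]
    have := hH.2 (adjUpd Γ H C y)
    have := mul_self_nonneg (kalmanGain Γ H C ⬝ᵥ y)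
    positivity

end Update

lemma dotProduct_predCov_mulVec (t : ℝ) (W : Matrix (Fin 3) (Fin 3) ℝ)
    (G : Matrix StateIdx StateIdx ℝ) (u y : StateIdx → ℝ) :
    u ⬝ᵥ predCov t W G *ᵥ y = (matA t)ᵀ *ᵥ u ⬝ᵥ G *ᵥ ((matA t)ᵀ *ᵥ y)
      + (matB t)ᵀ *ᵥ u ⬝ᵥ W *ᵥ ((matB t)ᵀ *ᵥ y) := by
  rw [predCov, add_mulVec, dotProduct_add, ← mulVec_mulVec, ← mulVec_mulVec, ← mulVec_mulVec,
    ← mulVec_mulVec, dotProduct_mulVec u, dotProduct_mulVec u (matB t), ← mulVec_transpose,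
    ← mulVec_transpose]

lemma isSymmNonneg_predCov (t : ℝ) {W : Matrix (Fin 3) (Fin 3) ℝ}
    {G : Matrix StateIdx StateIdx ℝ} (hW : IsSymmNonneg W) (hG : IsSymmNonneg G) :
    IsSymmNonneg (predCov t W G) := by
  refine ⟨fun u y => ?_, fun y => ?_⟩
  · rw [dotProduct_predCov_mulVec, dotProduct_predCov_mulVec, hG.1, hW.1]
  · rw [dotProduct_predCov_mulVec]
    exact add_nonneg (hG.2 _) (hW.2 _)

/-! ### The system matrices in coordinates -/

section Coordinates

variable (t : ℝ)

lemma matA_mulVec (x : StateIdx → ℝ) : matA t *ᵥ x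
    = Sum.elim (fun i => x (Sum.inl i) + t * x (Sum.inr i)) (fun i => x (Sum.inr i)) := by
  rw [← Sum.elim_comp_inl_inr x, matA, fromBlocks_mulVec]
  ext (i | i) <;> simp [smul_mulVec]

lemma matA_transpose_mulVec (x : StateIdx → ℝ) : (matA t)ᵀ *ᵥ x
    = Sum.elim (fun i => x (Sum.inl i)) (fun i => t * x (Sum.inl i) + x (Sum.inr i)) := by
  rw [← Sum.elim_comp_inl_inr x, matA, fromBlocks_transpose, fromBlocks_mulVec]
  ext (i | i) <;> simp [smul_mulVec]

lemma matB_mulVec (b : Fin 3 → ℝ) : matB t *ᵥ b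
    = Sum.elim (fun i => t ^ 2 / 2 * b i) (fun i => t * b i) := by
  rw [matB, fromRows_mulVec]
  ext (i | i) <;> simp [smul_mulVec]

lemma matB_transpose_mulVec (x : StateIdx → ℝ) : (matB t)ᵀ *ᵥ x
    = fun i => t ^ 2 / 2 * x (Sum.inl i) + t * x (Sum.inr i) := by
  rw [← Sum.elim_comp_inl_inr x, matB, transpose_fromRows, fromCols_mulVec]
  ext i
  simp [smul_mulVec]

lemma matA_transpose_sq_le (x : StateIdx → ℝ) :
    (matA t)ᵀ *ᵥ x ⬝ᵥ (matA t)ᵀ *ᵥ x ≤ (2 + 2 * t ^ 2) * (x ⬝ᵥ x) := by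
  rw [matA_transpose_mulVec]
  simp only [dotProduct, Fintype.sum_sum_type, Sum.elim_inl, Sum.elim_inr,
    ← Finset.sum_add_distrib, Finset.mul_sum]
  refine Finset.sum_le_sum fun i _ => ?_
  nlinarith [sq_nonneg (t * x (Sum.inl i) - x (Sum.inr i)), sq_nonneg (t * x (Sum.inr i)),
    sq_nonneg (x (Sum.inl i))]

lemma matB_sq (b : Fin 3 → ℝ) :
    matB t *ᵥ b ⬝ᵥ matB t *ᵥ b = (t ^ 4 / 4 + t ^ 2) * (b ⬝ᵥ b) := by
  rw [matB_mulVec]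
  simp only [dotProduct, Fintype.sum_sum_type, Sum.elim_inl, Sum.elim_inr,
    ← Finset.sum_add_distrib, Finset.mul_sum]
  exact Finset.sum_congr rfl fun i _ => by ring

lemma matB_transpose_sq_le (x : StateIdx → ℝ) :
    (matB t)ᵀ *ᵥ x ⬝ᵥ (matB t)ᵀ *ᵥ x ≤ (t ^ 4 / 4 + t ^ 2) * (x ⬝ᵥ x) := by
  rw [matB_transpose_mulVec]
  simp only [dotProduct, Fintype.sum_sum_type,
    ← Finset.sum_add_distrib, Finset.mul_sum]
  refine Finset.sum_le_sum fun i _ => ?_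
  nlinarith [sq_nonneg (t ^ 2 / 2 * x (Sum.inr i) - t * x (Sum.inl i))]

/-- Controllability of `(A, B)` in two steps. -/
lemma le_controllability (ht : 0 < t) (x : StateIdx → ℝ) :
    x ⬝ᵥ x ≤ (4 / t ^ 4 + 10 / t ^ 2) * ((matB t)ᵀ *ᵥ x ⬝ᵥ (matB t)ᵀ *ᵥ x
      + (matB t)ᵀ *ᵥ ((matA t)ᵀ *ᵥ x) ⬝ᵥ (matB t)ᵀ *ᵥ ((matA t)ᵀ *ᵥ x)) := by
  rw [matB_transpose_mulVec, matB_transpose_mulVec, matA_transpose_mulVec]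
  simp only [dotProduct, Fintype.sum_sum_type, Sum.elim_inl, Sum.elim_inr,
    ← Finset.sum_add_distrib, Finset.mul_sum]
  refine Finset.sum_le_sum fun i _ => ?_
  set a := t ^ 2 / 2 * x (Sum.inl i) + t * x (Sum.inr i) with ha
  set b := t ^ 2 / 2 * x (Sum.inl i) + t * (t * x (Sum.inl i) + x (Sum.inr i)) with hb
  have h1 : x (Sum.inl i) = (b - a) / t ^ 2 := by
    rw [ha, hb]
    field_simp
    ring
  have h2 : x (Sum.inr i) = (3 * a - b) / (2 * t) := by
    rw [ha, hb]
    field_simp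
    ring
  rw [h1, h2]
  have e1 : (b - a) / t ^ 2 * ((b - a) / t ^ 2) + (3 * a - b) / (2 * t) * ((3 * a - b) / (2 * t))
      = 1 / t ^ 4 * (b - a) ^ 2 + 1 / t ^ 2 * ((3 * a - b) ^ 2 / 4) := by
    field_simp
    ring
  have e2 : (4 / t ^ 4 + 10 / t ^ 2) * (a * a + b * b)
      = 1 / t ^ 4 * (4 * (a ^ 2 + b ^ 2)) + 1 / t ^ 2 * (10 * (a ^ 2 + b ^ 2)) := by ring
  rw [e1, e2]
  gcongr
  · nlinarith [sq_nonneg (a + b)]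
  · nlinarith [sq_nonneg (3 * b + a)]

lemma outRow_sq (q : Vec3) : outRow q ⬝ᵥ outRow q = ‖q‖ ^ 2 := by
  rw [EuclideanSpace.real_norm_sq_eq]
  simp [outRow, dotProduct, sq]

lemma outRow_dotProduct (q : Vec3) (x : StateIdx → ℝ) :
    outRow q ⬝ᵥ x = inner ℝ q (pos (WithLp.toLp 2 x)) := by
  simp [outRow, dotProduct, pos, PiLp.inner_apply, mul_comm]

end Coordinates

/-! ### Persistent excitation and observability -/

/-- The pathwise relation, up to step `T`, between the relative position `q` of the guardians and
the shape `z`: under the control law, `q` follows `q⁺ = λ q - 2 (z⁺ - α z)` with an unspecified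
factor `|λ| ≤ Λ < 1` that stands for the saturated feedback, from `‖q 0‖ ≤ R`; the shape is bounded
and persistently exciting. -/
structure IsExcitedPath (α Λ R r a : ℝ) (N T : ℕ) (q z : ℕ → Vec3) : Prop where
  norm_init : ‖q 0‖ ≤ R
  norm_shape : ∀ k, ‖z k‖ ≤ r
  excited : ∀ k (y : Vec3), a * ‖y‖ ^ 2 ≤ ∑ m ∈ Finset.Ico k (k + N), inner ℝ (z m) y ^ 2
  step : ∀ k < T, ∃ l : ℝ, |l| ≤ Λ ∧ q (k + 1) = l • q k - (2 : ℝ) • (z (k + 1) - α • z k)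

/-- A bound on the relative position of the guardians along an excited path. -/
def relBound (Λ R r : ℝ) : ℝ := max |R| (4 * |r| / (1 - Λ))

lemma relBound_nonneg (Λ R r : ℝ) : 0 ≤ relBound Λ R r := (abs_nonneg R).trans (le_max_left _ _)

namespace IsExcitedPath

variable {α Λ R r a : ℝ} {N T : ℕ} {q z : ℕ → Vec3}

lemma norm_le (h : IsExcitedPath α Λ R r a N T q z) (hα : |α| ≤ 1) (hΛ : Λ < 1) :
    ∀ k ≤ T, ‖q k‖ ≤ relBound Λ R r := by
  intro k
  induction k with
  | zero => exact fun _ => h.norm_init.trans ((le_abs_self R).trans (le_max_left _ _))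
  | succ k ih =>
    intro hk
    obtain ⟨l, hl, hq⟩ := h.step k hk
    have h1 := ih (by omega)
    have h2 : 4 * |r| ≤ relBound Λ R r * (1 - Λ) := by
      rw [← div_le_iff₀ (by linarith)]
      exact le_max_right _ _
    have h3 : ‖z (k + 1)‖ ≤ |r| := (h.norm_shape _).trans (le_abs_self r)
    have h4 : ‖α • z k‖ ≤ |r| := by
      rw [norm_smul, Real.norm_eq_abs]
      have := (h.norm_shape k).trans (le_abs_self r)
      nlinarith [norm_nonneg (z k), abs_nonneg α]
    have h5 : ‖l • q k‖ ≤ Λ * relBound Λ R r := by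
      rw [norm_smul, Real.norm_eq_abs]
      exact mul_le_mul hl h1 (norm_nonneg _) ((abs_nonneg l).trans hl)
    rw [hq]
    calc _ ≤ ‖l • q k‖ + ‖(2 : ℝ) • (z (k + 1) - α • z k)‖ := norm_sub_le _ _
      _ ≤ Λ * relBound Λ R r + 2 * (|r| + |r|) := by
        rw [norm_smul (2 : ℝ)]
        norm_num
        gcongr
        exact (norm_sub_le _ _).trans (add_le_add h3 h4)
      _ ≤ _ := by linarith

/-- If a fixed direction `y` is nearly orthogonal to `q` along a window, its component along the
shape decays like `α ^ i`. -/
lemma abs_inner_shape_le (h : IsExcitedPath α Λ R r a N T q z) (hα : |α| < 1) (hΛ : Λ ≤ 1)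
    {s n : ℕ} (hs : s + n ≤ T) {y : Vec3} {ε : ℝ}
    (hy : ∀ i ≤ n, |inner ℝ (q (s + i)) y| ≤ ε) :
    ∀ i ≤ n, |inner ℝ (z (s + i)) y| ≤ |α| ^ i * (r * ‖y‖) + ε / (1 - |α|) := by
  have hε : 0 ≤ ε := (abs_nonneg _).trans (hy 0 (Nat.zero_le n))
  have hα' : 0 < 1 - |α| := by linarith
  intro i
  induction i with
  | zero =>
    intro _
    have h1 : |inner ℝ (z (s + 0)) y| ≤ r * ‖y‖ := (abs_real_inner_le_norm _ _).trans
      (mul_le_mul_of_nonneg_right (h.norm_shape _) (norm_nonneg y))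
    have : 0 ≤ ε / (1 - |α|) := by positivity
    simp only [pow_zero, one_mul]
    linarith
  | succ i ih =>
    intro hi
    obtain ⟨l, hl, hq⟩ := h.step (s + i) (by omega)
    have h1 := ih (by omega)
    have h2 := hy i (by omega)
    have h3 := hy (i + 1) hi
    rw [← add_assoc] at h3 ⊢
    have h4 : inner ℝ (z (s + i + 1)) y = α * inner ℝ (z (s + i)) y
        + (l * inner ℝ (q (s + i)) y - inner ℝ (q (s + i + 1)) y) / 2 := by
      rw [hq]
      simp only [inner_sub_left, real_inner_smul_left]
      ring
    have h5 : |l * inner ℝ (q (s + i)) y| ≤ 1 * ε := by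
      rw [abs_mul]
      exact mul_le_mul (hl.trans hΛ) h2 (abs_nonneg _) zero_le_one
    have h6 : |(l * inner ℝ (q (s + i)) y - inner ℝ (q (s + i + 1)) y) / 2| ≤ ε := by
      rw [abs_div, abs_two]
      have := abs_sub (l * inner ℝ (q (s + i)) y) (inner ℝ (q (s + i + 1)) y)
      linarith
    have h7 : |α * inner ℝ (z (s + i)) y| ≤ |α| * (|α| ^ i * (r * ‖y‖) + ε / (1 - |α|)) := by
      rw [abs_mul]
      exact mul_le_mul_of_nonneg_left h1 (abs_nonneg α)
    have h8 : |α| * (ε / (1 - |α|)) + ε = ε / (1 - |α|) := by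
      field_simp
      ring
    rw [h4]
    calc _ ≤ _ := abs_add_le _ _
      _ ≤ |α| * (|α| ^ i * (r * ‖y‖) + ε / (1 - |α|)) + ε := add_le_add h7 h6
      _ = |α| ^ (i + 1) * (r * ‖y‖) + (|α| * (ε / (1 - |α|)) + ε) := by ring
      _ = _ := by rw [h8]

end IsExcitedPath

/-- The relative position inherits the persistent excitation of the shape: a fixed direction that
is nearly orthogonal to `q` along a window of a certain length is short. -/
lemma exists_norm_le_of_inner_le {α Λ r a : ℝ} (R : ℝ) (N : ℕ) (hα : |α| < 1) (hΛ : Λ ≤ 1)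
    (ha : 0 < a) : ∃ (n : ℕ) (K : ℝ), 0 < K ∧ ∀ (T : ℕ) (q z : ℕ → Vec3),
      IsExcitedPath α Λ R r a N T q z → ∀ s, s + n ≤ T → ∀ (y : Vec3) (ε : ℝ),
        (∀ i ≤ n, |inner ℝ (q (s + i)) y| ≤ ε) → ‖y‖ ≤ K * ε := by
  -- `n₀` makes the transient `|α| ^ n₀ r` small against the excitation level `a / N`
  obtain ⟨n₀, hn₀⟩ : ∃ n₀ : ℕ, |α| ^ n₀ * (√N * |r|) < √a / 2 := by
    have h1 : Filter.Tendsto (fun n : ℕ => |α| ^ n * (√N * |r|)) Filter.atTop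
        (nhds (0 * (√N * |r|))) :=
      (tendsto_pow_atTop_nhds_zero_of_lt_one (abs_nonneg α) hα).mul_const _
    rw [zero_mul] at h1
    exact (h1.eventually (gt_mem_nhds (by positivity))).exists
  have hα' : 0 < 1 - |α| := by linarith
  refine ⟨n₀ + N, (√N / (1 - |α|) + 1) / (√a / 2), by positivity, ?_⟩
  intro T q z h s hs y ε hy
  have hε : 0 ≤ ε := (abs_nonneg _).trans (hy 0 (Nat.zero_le _))
  have hr : 0 ≤ r := (norm_nonneg _).trans (h.norm_shape 0)
  have h1 := h.abs_inner_shape_le hα hΛ hs hy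
  set δ := |α| ^ n₀ * (r * ‖y‖) + ε / (1 - |α|) with hδ
  have hδ0 : 0 ≤ δ := by positivity
  have h2 : a * ‖y‖ ^ 2 ≤ N * δ ^ 2 := by
    refine (h.excited (s + n₀) y).trans ?_
    have h3 : ∀ m ∈ Finset.Ico (s + n₀) (s + n₀ + N), inner ℝ (z m) y ^ 2 ≤ δ ^ 2 := by
      intro m hm
      rw [Finset.mem_Ico] at hm
      obtain ⟨i, rfl⟩ := Nat.exists_eq_add_of_le (show s ≤ m by omega)
      have h4 := h1 i (by omega)
      have h5 : |α| ^ i ≤ |α| ^ n₀ := pow_le_pow_of_le_one (abs_nonneg α) hα.le (by omega)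
      rw [← sq_abs]
      have h6 : |inner ℝ (z (s + i)) y| ≤ δ := h4.trans (by rw [hδ]; gcongr)
      gcongr
    refine (Finset.sum_le_sum h3).trans ?_
    simp
  have h3 : √a * ‖y‖ ≤ √N * δ := by
    have h4 := Real.sqrt_le_sqrt h2
    rwa [Real.sqrt_mul ha.le, Real.sqrt_mul (Nat.cast_nonneg N), Real.sqrt_sq (norm_nonneg y),
      Real.sqrt_sq hδ0] at h4
  have h4 : |α| ^ n₀ * (√N * r) * ‖y‖ ≤ √a / 2 * ‖y‖ := by
    rw [abs_of_nonneg hr] at hn₀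
    exact mul_le_mul_of_nonneg_right hn₀.le (norm_nonneg y)
  rw [div_mul_eq_mul_div, le_div_iff₀ (by positivity)]
  have h5 : √N * δ = |α| ^ n₀ * (√N * r) * ‖y‖ + √N / (1 - |α|) * ε := by
    rw [hδ]
    ring
  nlinarith

/-- Uniform observability, robust against disturbances: if a trajectory of the double integrator
with disturbances of size `ε` has outputs `q · p` of size `ε` along a window of a certain length,
then its end point is of size `ε`. -/
lemma exists_observability {α Λ r a t : ℝ} (R : ℝ) (N : ℕ) (hα : |α| < 1) (hΛ : Λ < 1)
    (ha : 0 < a) (ht : 0 < t) : ∃ (L : ℕ) (K : ℝ), 0 < K ∧ ∀ (T : ℕ) (q z : ℕ → Vec3),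
      IsExcitedPath α Λ R r a N T q z → ∀ s, s + L ≤ T → ∀ (p v : ℕ → Vec3) (ε : ℝ),
        (∀ i < L, ‖p (s + i + 1) - (p (s + i) + t • v (s + i))‖ ≤ ε) →
        (∀ i < L, ‖v (s + i + 1) - v (s + i)‖ ≤ ε) →
        (∀ i ≤ L, |inner ℝ (q (s + i)) (p (s + i))| ≤ ε) → 0 ≤ ε →
        ‖p (s + L)‖ ≤ K * ε ∧ ‖v (s + L)‖ ≤ K * ε := by
  obtain ⟨n, K₁, hK₁, hobs⟩ := exists_norm_le_of_inner_le (r := r) R N hα hΛ.le ha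
  set b := relBound Λ R r with hb
  have hb0 : 0 ≤ b := relBound_nonneg Λ R r
  -- `M` steps of the motion dominate the error `c₃ ‖v‖` made in freezing the direction of `p`
  set c₃ := K₁ * b * (n * t) with hc₃
  have hc₃0 : 0 ≤ c₃ := by positivity
  obtain ⟨M, hM⟩ := exists_nat_gt ((2 * c₃ + 1) / t)
  rw [div_lt_iff₀ ht] at hM
  set L := M + n with hL
  set c₁ := L * (1 + t * L) with hc₁
  have hc₁0 : 0 ≤ c₁ := by positivity
  set c₂ := K₁ * (1 + 2 * b * c₁) with hc₂
  have hc₂0 : 0 ≤ c₂ := by positivity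
  set Kv := 2 * c₂ + c₁ with hKv
  have hKv0 : 0 ≤ Kv := by positivity
  refine ⟨L, (c₂ + c₃ * Kv) + (L * t * Kv + c₁) + (Kv + L) + 1, by positivity, ?_⟩
  intro T q z h s hs p v ε hp hv hq hε
  have hvi : ∀ i ≤ L, ‖v (s + i) - v s‖ ≤ i * ε := by
    intro i
    induction i with
    | zero => simp
    | succ i ih =>
      intro hi
      have h1 := ih (by omega)
      have h2 := hv i (by omega)
      rw [← add_assoc]
      calc _ = ‖(v (s + i + 1) - v (s + i)) + (v (s + i) - v s)‖ := by congr 1; abel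
        _ ≤ ε + i * ε := (norm_add_le _ _).trans (add_le_add h2 h1)
        _ = _ := by push_cast; ring
  have hpi : ∀ i ≤ L, ‖p (s + i) - p s - ((i : ℝ) * t) • v s‖ ≤ i * (1 + t * L) * ε := by
    intro i
    induction i with
    | zero => simp
    | succ i ih =>
      intro hi
      have h1 := ih (by omega)
      have h2 := hp i (by omega)
      have h3 : ‖t • (v (s + i) - v s)‖ ≤ t * (L * ε) := by
        rw [norm_smul, Real.norm_eq_abs, abs_of_pos ht]
        have h4 := hvi i (by omega)
        have h5 : (i : ℝ) ≤ L := by exact_mod_cast (show i ≤ L by omega)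
        gcongr
        exact h4.trans (by gcongr)
      rw [← add_assoc]
      calc _ = ‖(p (s + i + 1) - (p (s + i) + t • v (s + i))) + t • (v (s + i) - v s)
              + (p (s + i) - p s - ((i : ℝ) * t) • v s)‖ := by
            congr 1
            push_cast
            module
        _ ≤ ε + t * (L * ε) + i * (1 + t * L) * ε :=
            (norm_add_le _ _).trans (add_le_add ((norm_add_le _ _).trans (add_le_add h2 h3)) h1)
        _ = _ := by push_cast; ring
  have hpc : ∀ i ≤ L, ‖p (s + i) - p s - ((i : ℝ) * t) • v s‖ ≤ c₁ * ε := by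
    intro i hi
    have h5 : (i : ℝ) ≤ L := by exact_mod_cast hi
    refine (hpi i hi).trans ?_
    rw [hc₁]
    gcongr
  have hqb := h.norm_le hα.le hΛ
  -- the observability of a frozen direction, at the two ends of the window of length `M`
  have key : ∀ j, j + n ≤ L → ‖p (s + j)‖ ≤ c₂ * ε + c₃ * ‖v s‖ := by
    intro j hj
    have hfr : ∀ i ≤ n, ‖p (s + j + i) - p (s + j)‖ ≤ n * t * ‖v s‖ + 2 * (c₁ * ε) := by
      intro i hi
      have h1 := hpc (j + i) (by omega)
      have h2 := hpc j (by omega)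
      rw [← add_assoc] at h1
      have h3 : ‖((i : ℝ) * t) • v s‖ ≤ n * t * ‖v s‖ := by
        rw [norm_smul, Real.norm_eq_abs, abs_of_nonneg (by positivity)]
        have : (i : ℝ) ≤ n := by exact_mod_cast hi
        gcongr
      calc _ = ‖((i : ℝ) * t) • v s + (p (s + j + i) - p s - (((j + i : ℕ) : ℝ) * t) • v s)
              - (p (s + j) - p s - ((j : ℝ) * t) • v s)‖ := by
            congr 1
            push_cast
            module
        _ ≤ n * t * ‖v s‖ + c₁ * ε + c₁ * ε :=
            (norm_sub_le _ _).trans (add_le_add ((norm_add_le _ _).trans (add_le_add h3 h1)) h2)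
        _ = _ := by ring
    have h1 := hobs T q z h (s + j) (by omega) (p (s + j))
      (ε + b * (n * t * ‖v s‖ + 2 * (c₁ * ε))) ?_
    · rw [hc₂, hc₃]
      linarith
    · intro i hi
      have h2 := hq (j + i) (by omega)
      rw [← add_assoc] at h2
      have h3 : inner ℝ (q (s + j + i)) (p (s + j)) = inner ℝ (q (s + j + i)) (p (s + j + i))
          - inner ℝ (q (s + j + i)) (p (s + j + i) - p (s + j)) := by
        rw [inner_sub_right]
        ring
      have h4 := (abs_real_inner_le_norm (q (s + j + i)) (p (s + j + i) - p (s + j))).trans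
        (mul_le_mul (hqb _ (by omega)) (hfr i hi) (norm_nonneg _) hb0)
      rw [h3]
      exact (abs_sub _ _).trans (add_le_add h2 h4)
  have hp0 := key 0 (by omega)
  have hpM := key M le_rfl
  rw [add_zero] at hp0
  have hV : ‖v s‖ ≤ Kv * ε := by
    have h1 : ‖((M : ℝ) * t) • v s‖ ≤ (c₂ * ε + c₃ * ‖v s‖) + (c₂ * ε + c₃ * ‖v s‖) + c₁ * ε := by
      calc _ = ‖p (s + M) - p s - (p (s + M) - p s - ((M : ℝ) * t) • v s)‖ := by
            congr 1
            module
        _ ≤ _ := (norm_sub_le _ _).trans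
            (add_le_add ((norm_sub_le _ _).trans (add_le_add hpM hp0)) (hpc M (by omega)))
    rw [norm_smul, Real.norm_eq_abs, abs_of_nonneg (by positivity)] at h1
    have h2 : (2 * c₃ + 1) * ‖v s‖ ≤ M * t * ‖v s‖ :=
      mul_le_mul_of_nonneg_right hM.le (norm_nonneg _)
    rw [hKv]
    linarith
  have hpL : ‖p (s + L)‖ ≤ (c₂ + c₃ * Kv) * ε + (L * t * Kv + c₁) * ε := by
    have h1 : ‖((L : ℝ) * t) • v s‖ ≤ L * t * (Kv * ε) := by
      rw [norm_smul, Real.norm_eq_abs, abs_of_nonneg (by positivity)]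
      gcongr
    have h2 : c₃ * ‖v s‖ ≤ c₃ * (Kv * ε) := mul_le_mul_of_nonneg_left hV hc₃0
    calc _ = ‖p s + ((L : ℝ) * t) • v s + (p (s + L) - p s - ((L : ℝ) * t) • v s)‖ := by
          congr 1
          module
      _ ≤ (c₂ * ε + c₃ * (Kv * ε)) + L * t * (Kv * ε) + c₁ * ε :=
          (norm_add_le _ _).trans (add_le_add ((norm_add_le _ _).trans
            (add_le_add (hp0.trans (by linarith)) h1)) (hpc L le_rfl))
      _ = _ := by ring
  have hvL : ‖v (s + L)‖ ≤ (Kv + L) * ε := by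
    calc _ = ‖v s + (v (s + L) - v s)‖ := by
          congr 1
          abel
      _ ≤ Kv * ε + L * ε := (norm_add_le _ _).trans (add_le_add hV (hvi L le_rfl))
      _ = _ := by ring
  have e1 : 0 ≤ (c₂ + c₃ * Kv) * ε := by positivity
  have e2 : 0 ≤ (L * t * Kv + c₁) * ε := by positivity
  have e3 : 0 ≤ (Kv + L) * ε := by positivity
  constructor <;> linarith

/-! ### Uniform bounds for the filter covariance -/

/-- The Riccati map of the Kalman filter: one prediction followed by one measurement update. -/
def covStep (t Γ : ℝ) (W : Matrix (Fin 3) (Fin 3) ℝ) (G : Matrix StateIdx StateIdx ℝ)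
    (q : Vec3) : Matrix StateIdx StateIdx ℝ :=
  updCov (predCov t W G) (kalmanGain Γ (predCov t W G) (outRow q)) (outRow q)

/-- The adjoint of the measurement update, for the gain computed from the covariance `G`. -/
def adjMid (t Γ : ℝ) (W : Matrix (Fin 3) (Fin 3) ℝ) (G : Matrix StateIdx StateIdx ℝ)
    (q : Vec3) (y : StateIdx → ℝ) : StateIdx → ℝ :=
  adjUpd Γ (predCov t W G) (outRow q) y

/-- The component of `y` along the gain computed from the covariance `G`. -/
def adjOut (t Γ : ℝ) (W : Matrix (Fin 3) (Fin 3) ℝ) (G : Matrix StateIdx StateIdx ℝ)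
    (q : Vec3) (y : StateIdx → ℝ) : ℝ :=
  kalmanGain Γ (predCov t W G) (outRow q) ⬝ᵥ y

/-- Data of the noise covariances: `0 < Γ`, and `wl I ≤ W ≤ wh I` with `0 < wl`. -/
structure NoiseBounds (Γ wl wh : ℝ) (W : Matrix (Fin 3) (Fin 3) ℝ) : Prop where
  Γ_pos : 0 < Γ
  wl_pos : 0 < wl
  symm : IsSymmNonneg W
  lower : ∀ b : Fin 3 → ℝ, wl * (b ⬝ᵥ b) ≤ b ⬝ᵥ W *ᵥ b
  upper : ∀ b : Fin 3 → ℝ, b ⬝ᵥ W *ᵥ b ≤ wh * (b ⬝ᵥ b)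

section Step

variable {t Γ wl wh : ℝ} {W : Matrix (Fin 3) (Fin 3) ℝ} {G : Matrix StateIdx StateIdx ℝ}

lemma NoiseBounds.wl_le_wh (hN : NoiseBounds Γ wl wh W) : wl ≤ wh := by
  have h1 := (hN.lower (fun _ => 1)).trans (hN.upper _)
  have h2 : (0 : ℝ) < (fun _ : Fin 3 => (1 : ℝ)) ⬝ᵥ fun _ => 1 := by simp [dotProduct]
  exact le_of_mul_le_mul_right h1 h2

lemma isSymmNonneg_covStep (hN : NoiseBounds Γ wl wh W) (hG : IsSymmNonneg G) (q : Vec3) :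
    IsSymmNonneg (covStep t Γ W G q) :=
  isSymmNonneg_updCov hN.Γ_pos (isSymmNonneg_predCov t hN.symm hG) _

/-- The energy balance of one filter step: the covariance after the step, evaluated at `y`, is the
covariance before the step, evaluated at the adjoint image of `y`, plus the contributions of the
acceleration and of the output noise. -/
lemma dotProduct_covStep (hN : NoiseBounds Γ wl wh W) (hG : IsSymmNonneg G) (q : Vec3)
    (y : StateIdx → ℝ) : y ⬝ᵥ covStep t Γ W G q *ᵥ y
      = (matA t)ᵀ *ᵥ adjMid t Γ W G q y ⬝ᵥ G *ᵥ ((matA t)ᵀ *ᵥ adjMid t Γ W G q y)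
        + (matB t)ᵀ *ᵥ adjMid t Γ W G q y ⬝ᵥ W *ᵥ ((matB t)ᵀ *ᵥ adjMid t Γ W G q y)
        + Γ * adjOut t Γ W G q y ^ 2 := by
  rw [covStep, dotProduct_updCov_mulVec hN.Γ_pos (isSymmNonneg_predCov t hN.symm hG),
    dotProduct_predCov_mulVec, sq]
  rfl

/-- A measurement does not increase the covariance. -/
lemma dotProduct_covStep_le (hN : NoiseBounds Γ wl wh W) (hG : IsSymmNonneg G) (q : Vec3)
    (y : StateIdx → ℝ) : y ⬝ᵥ covStep t Γ W G q *ᵥ y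
      ≤ (matA t)ᵀ *ᵥ y ⬝ᵥ G *ᵥ ((matA t)ᵀ *ᵥ y)
        + (matB t)ᵀ *ᵥ y ⬝ᵥ W *ᵥ ((matB t)ᵀ *ᵥ y) := by
  have hH := isSymmNonneg_predCov t hN.symm hG
  have hs := innovVar_pos hN.Γ_pos hH (outRow q)
  have h1 := dotProduct_mulVec_eq_gain hN.Γ_pos hH (outRow q) y
  rw [← dotProduct_predCov_mulVec, covStep, updCov_mulVec hN.Γ_pos hH, adjUpd, mulVec_sub,
    mulVec_smul, dotProduct_sub, dotProduct_smul, hH.1 y (outRow q), h1, smul_eq_mul]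
  nlinarith [mul_nonneg hs.le
    (mul_self_nonneg (kalmanGain Γ (predCov t W G) (outRow q) ⬝ᵥ y))]

lemma covStep_mulVec (hN : NoiseBounds Γ wl wh W) (hG : IsSymmNonneg G) (q : Vec3)
    (y : StateIdx → ℝ) : covStep t Γ W G q *ᵥ y
      = matA t *ᵥ (G *ᵥ ((matA t)ᵀ *ᵥ adjMid t Γ W G q y))
        + matB t *ᵥ (W *ᵥ ((matB t)ᵀ *ᵥ adjMid t Γ W G q y)) := by
  rw [covStep, updCov_mulVec hN.Γ_pos (isSymmNonneg_predCov t hN.symm hG)]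
  rw [predCov, add_mulVec, ← mulVec_mulVec, ← mulVec_mulVec, ← mulVec_mulVec, ← mulVec_mulVec]
  rfl

lemma outRow_dotProduct_covStep (hN : NoiseBounds Γ wl wh W) (hG : IsSymmNonneg G) (q : Vec3)
    (y : StateIdx → ℝ) :
    outRow q ⬝ᵥ covStep t Γ W G q *ᵥ y = Γ * adjOut t Γ W G q y :=
  outRow_dotProduct_updCov hN.Γ_pos (isSymmNonneg_predCov t hN.symm hG) _ _

lemma eq_adjMid_add (q : Vec3) (y : StateIdx → ℝ) :
    y = adjMid t Γ W G q y + adjOut t Γ W G q y • outRow q := by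
  simp [adjMid, adjUpd, adjOut]

/-- Over two steps the covariance gains a multiple of the identity, whatever the gains are, because
`(A, B)` is controllable in two steps. -/
lemma exists_two_step_gain {t Γ wl wh : ℝ} {W : Matrix (Fin 3) (Fin 3) ℝ} (ht : 0 < t)
    (hN : NoiseBounds Γ wl wh W) (c : ℝ) : ∃ δ : ℝ, 0 < δ ∧
      ∀ (G : Matrix StateIdx StateIdx ℝ) (q₁ q₂ : Vec3) (y : StateIdx → ℝ), IsSymmNonneg G →
        ‖q₁‖ ≤ c → ‖q₂‖ ≤ c →
        (let G₁ := covStep t Γ W G q₁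
         let y₁ := (matA t)ᵀ *ᵥ adjMid t Γ W G₁ q₂ y
         let y₀ := (matA t)ᵀ *ᵥ adjMid t Γ W G q₁ y₁
         y₀ ⬝ᵥ G *ᵥ y₀ + δ * (y ⬝ᵥ y) ≤ y ⬝ᵥ covStep t Γ W G₁ q₂ *ᵥ y) := by
  set κ := 4 / t ^ 4 + 10 / t ^ 2 with hκ
  set b := t ^ 4 / 4 + t ^ 2 with hb
  have hκ0 : 0 < κ := by positivity
  have hb0 : 0 < b := by positivity
  have hΓ := hN.Γ_pos
  have hw := hN.wl_pos
  set K := 4 * κ / wl + (4 * κ * b * c ^ 2 + 2 * c ^ 2) / Γ with hK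
  have hK0 : 0 < K := by positivity
  refine ⟨K⁻¹, by positivity, ?_⟩
  intro G q₁ q₂ y hG hq₁ hq₂ G₁ y₁ y₀
  have hG₁ : IsSymmNonneg G₁ := isSymmNonneg_covStep hN hG q₁
  have hE₂ : y ⬝ᵥ covStep t Γ W G₁ q₂ *ᵥ y = y₁ ⬝ᵥ G₁ *ᵥ y₁ + _ + _ :=
    dotProduct_covStep hN hG₁ q₂ y
  have hE₁ : y₁ ⬝ᵥ G₁ *ᵥ y₁ = y₀ ⬝ᵥ G *ᵥ y₀ + _ + _ := dotProduct_covStep hN hG q₁ y₁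
  set z₂ := adjMid t Γ W G₁ q₂ y with hz₂
  set z₁ := adjMid t Γ W G q₁ y₁ with hz₁
  set l₂ := adjOut t Γ W G₁ q₂ y with hl₂
  set l₁ := adjOut t Γ W G q₁ y₁ with hl₁
  have hy : y = z₂ + l₂ • outRow q₂ := eq_adjMid_add q₂ y
  have hy₁ : y₁ = z₁ + l₁ • outRow q₁ := eq_adjMid_add q₁ y₁
  have hc : ∀ (q : Vec3) (l : ℝ), ‖q‖ ≤ c → (l • outRow q) ⬝ᵥ (l • outRow q) ≤ c ^ 2 * l ^ 2 := by
    intro q l hq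
    rw [smul_dotProduct, dotProduct_smul, outRow_sq, smul_eq_mul, smul_eq_mul]
    have : ‖q‖ ^ 2 ≤ c ^ 2 := by gcongr
    nlinarith [mul_le_mul_of_nonneg_left this (sq_nonneg l)]
  have h1 : y ⬝ᵥ y ≤ 2 * (z₂ ⬝ᵥ z₂) + 2 * (c ^ 2 * l₂ ^ 2) := by
    have h := dotProduct_self_add_le z₂ (l₂ • outRow q₂)
    rw [← hy] at h
    linarith [hc q₂ l₂ hq₂]
  have h2 : z₂ ⬝ᵥ z₂ ≤ κ * ((matB t)ᵀ *ᵥ z₂ ⬝ᵥ (matB t)ᵀ *ᵥ z₂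
      + (matB t)ᵀ *ᵥ y₁ ⬝ᵥ (matB t)ᵀ *ᵥ y₁) := le_controllability t ht z₂
  have h3 : (matB t)ᵀ *ᵥ y₁ ⬝ᵥ (matB t)ᵀ *ᵥ y₁
      ≤ 2 * ((matB t)ᵀ *ᵥ z₁ ⬝ᵥ (matB t)ᵀ *ᵥ z₁) + 2 * (b * (c ^ 2 * l₁ ^ 2)) := by
    have h := dotProduct_self_add_le ((matB t)ᵀ *ᵥ z₁) ((matB t)ᵀ *ᵥ (l₁ • outRow q₁))
    rw [← mulVec_add, ← hy₁] at h
    have h' := matB_transpose_sq_le t (l₁ • outRow q₁)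
    rw [← hb] at h'
    have := mul_le_mul_of_nonneg_left (hc q₁ l₁ hq₁) hb0.le
    linarith
  have h4 := hN.lower ((matB t)ᵀ *ᵥ z₁)
  have h5 := hN.lower ((matB t)ᵀ *ᵥ z₂)
  set B₁ := (matB t)ᵀ *ᵥ z₁ ⬝ᵥ (matB t)ᵀ *ᵥ z₁ with hB₁
  set B₂ := (matB t)ᵀ *ᵥ z₂ ⬝ᵥ (matB t)ᵀ *ᵥ z₂ with hB₂
  clear_value κ b K z₁ z₂ l₁ l₂
  have hB₁0 : 0 ≤ B₁ := dotProduct_self_nonneg' _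
  have hB₂0 : 0 ≤ B₂ := dotProduct_self_nonneg' _
  clear_value B₁ B₂
  set E := wl * B₁ + wl * B₂ + Γ * l₁ ^ 2 + Γ * l₂ ^ 2 with hE
  have h6 : y ⬝ᵥ y ≤ K * E := by
    have e1 : y ⬝ᵥ y ≤ 4 * κ * (B₁ + B₂) + (4 * κ * b * c ^ 2 + 2 * c ^ 2) * (l₁ ^ 2 + l₂ ^ 2) := by
      have := mul_le_mul_of_nonneg_left h3 hκ0.le
      have : 0 ≤ κ * B₂ := by positivity
      have : 0 ≤ κ * b * c ^ 2 * l₂ ^ 2 := by positivity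
      have : 0 ≤ c ^ 2 * l₁ ^ 2 := by positivity
      linarith
    have hl : 0 ≤ Γ * (l₁ ^ 2 + l₂ ^ 2) := by positivity
    have hB : 0 ≤ wl * (B₁ + B₂) := by positivity
    have e2 : wl * (B₁ + B₂) ≤ E := by
      rw [hE]
      linarith
    have e3 : Γ * (l₁ ^ 2 + l₂ ^ 2) ≤ E := by
      rw [hE]
      linarith
    calc y ⬝ᵥ y ≤ 4 * κ * (B₁ + B₂) + (4 * κ * b * c ^ 2 + 2 * c ^ 2) * (l₁ ^ 2 + l₂ ^ 2) := e1
      _ = 4 * κ / wl * (wl * (B₁ + B₂))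
          + (4 * κ * b * c ^ 2 + 2 * c ^ 2) / Γ * (Γ * (l₁ ^ 2 + l₂ ^ 2)) := by field_simp
      _ ≤ 4 * κ / wl * E + (4 * κ * b * c ^ 2 + 2 * c ^ 2) / Γ * E :=
        add_le_add (mul_le_mul_of_nonneg_left e2 (by positivity))
          (mul_le_mul_of_nonneg_left e3 (by positivity))
      _ = K * E := by
        rw [hK]
        ring
  have h7 : K⁻¹ * (y ⬝ᵥ y) ≤ E := by
    rw [inv_mul_le_iff₀ hK0]
    exact h6
  rw [hE₂, hE₁]
  linarith

end Step

/-- A sequence of filter covariances along the relative positions `q`, started between `gl I` and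
`gh I`. -/
structure IsCovPath (t Γ gl gh : ℝ) (W : Matrix (Fin 3) (Fin 3) ℝ) (q : ℕ → Vec3)
    (G : ℕ → Matrix StateIdx StateIdx ℝ) : Prop where
  symm_init : IsSymmNonneg (G 0)
  lower_init : ∀ y : StateIdx → ℝ, gl * (y ⬝ᵥ y) ≤ y ⬝ᵥ G 0 *ᵥ y
  upper_init : ∀ y : StateIdx → ℝ, y ⬝ᵥ G 0 *ᵥ y ≤ gh * (y ⬝ᵥ y)
  step : ∀ k, G (k + 1) = covStep t Γ W (G k) (q (k + 1))

namespace IsCovPath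

variable {t Γ wl wh gl gh : ℝ} {W : Matrix (Fin 3) (Fin 3) ℝ} {q : ℕ → Vec3}
  {G : ℕ → Matrix StateIdx StateIdx ℝ}

lemma symm (h : IsCovPath t Γ gl gh W q G) (hN : NoiseBounds Γ wl wh W) :
    ∀ k, IsSymmNonneg (G k)
  | 0 => h.symm_init
  | k + 1 => by
    rw [h.step]
    exact isSymmNonneg_covStep hN (h.symm hN k) _

/-- The vectors `x m = G m (y m)`, where `y` runs backwards through the adjoint filter from
`y n = y`, form a trajectory of the motion model; its disturbances and outputs are controlled by the
covariance `y · G n y`. -/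
lemma exists_trajectory (h : IsCovPath t Γ gl gh W q G) (hN : NoiseBounds Γ wl wh W) (n : ℕ) :
    ∀ y : StateIdx → ℝ, ∃ x : ℕ → StateIdx → ℝ, x n = G n *ᵥ y ∧ ∀ m < n,
      (x (m + 1) - matA t *ᵥ x m) ⬝ᵥ (x (m + 1) - matA t *ᵥ x m)
        ≤ ((t ^ 4 / 4 + t ^ 2) * wh) * (y ⬝ᵥ G n *ᵥ y) ∧
      (outRow (q (m + 1)) ⬝ᵥ x (m + 1)) ^ 2 ≤ Γ * (y ⬝ᵥ G n *ᵥ y) := by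
  have hwh : 0 < wh := hN.wl_pos.trans_le hN.wl_le_wh
  have hΓ := hN.Γ_pos
  induction n with
  | zero => exact fun y => ⟨fun _ => G 0 *ᵥ y, rfl, fun m hm => absurd hm (Nat.not_lt_zero m)⟩
  | succ n ih =>
    intro y
    have hG := h.symm hN n
    have hE := dotProduct_covStep (t := t) hN hG (q (n + 1)) y
    have hx := covStep_mulVec (t := t) hN hG (q (n + 1)) y
    have ho := outRow_dotProduct_covStep (t := t) hN hG (q (n + 1)) y
    rw [← h.step] at hE hx ho
    set E := y ⬝ᵥ G (n + 1) *ᵥ y with hEdef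
    set z := adjMid t Γ W (G n) (q (n + 1)) y with hz
    set l := adjOut t Γ W (G n) (q (n + 1)) y with hl
    obtain ⟨x, hxn, hxm⟩ := ih ((matA t)ᵀ *ᵥ z)
    have h1 := hG.2 ((matA t)ᵀ *ᵥ z)
    have h2 := hN.symm.2 ((matB t)ᵀ *ᵥ z)
    have h3 : 0 ≤ Γ * l ^ 2 := by positivity
    refine ⟨fun m => if m ≤ n then x m else G (n + 1) *ᵥ y, by simp, fun m hm => ?_⟩
    rcases Nat.lt_succ_iff_lt_or_eq.1 hm with hm' | rfl
    · have h4 := hxm m hm'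
      have h5 : m ≤ n := hm'.le
      have h6 : m + 1 ≤ n := hm'
      simp only [h5, h6, if_true]
      refine ⟨h4.1.trans ?_, h4.2.trans ?_⟩ <;> gcongr <;> linarith
    · simp only [le_refl, if_true, Nat.not_succ_le_self, if_false]
      constructor
      · rw [hxn, hx, add_sub_cancel_left, matB_sq, mul_assoc]
        have h4 := hN.symm.mulVec_self_le hN.upper ((matB t)ᵀ *ᵥ z)
        have h5 : wh * ((matB t)ᵀ *ᵥ z ⬝ᵥ W *ᵥ ((matB t)ᵀ *ᵥ z))
            ≤ wh * E := by
          gcongr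
          linarith
        have h6 : 0 ≤ t ^ 4 / 4 + t ^ 2 := by positivity
        exact mul_le_mul_of_nonneg_left (h4.trans h5) h6
      · rw [ho, mul_pow, sq Γ, mul_assoc]
        gcongr
        linarith

end IsCovPath

/-- On a bounded time interval the covariance is bounded because a single step is. -/
lemma exists_covariance_le_of_le {Γ wl wh : ℝ} {W : Matrix (Fin 3) (Fin 3) ℝ} (t gl gh : ℝ)
    (hN : NoiseBounds Γ wl wh W) (M : ℕ) :
    ∃ g : ℝ, 0 < g ∧ ∀ (q : ℕ → Vec3) (G : ℕ → Matrix StateIdx StateIdx ℝ),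
      IsCovPath t Γ gl gh W q G → ∀ k ≤ M, ∀ y, y ⬝ᵥ G k *ᵥ y ≤ g * (y ⬝ᵥ y) := by
  have hwh : 0 < wh := hN.wl_pos.trans_le hN.wl_le_wh
  induction M with
  | zero =>
    refine ⟨|gh| + 1, by positivity, fun q G h k hk y => ?_⟩
    obtain rfl : k = 0 := by omega
    refine (h.upper_init y).trans ?_
    have := dotProduct_self_nonneg' y
    gcongr
    linarith [le_abs_self gh]
  | succ M ih =>
    obtain ⟨g, hg, hgM⟩ := ih
    refine ⟨g + (g * (2 + 2 * t ^ 2) + wh * (t ^ 4 / 4 + t ^ 2)), by positivity, ?_⟩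
    intro q G h k hk y
    have hy := dotProduct_self_nonneg' y
    rcases Nat.le_succ_iff.1 hk with hk' | rfl
    · refine (hgM q G h k hk' y).trans ?_
      gcongr
      have : 0 ≤ g * (2 + 2 * t ^ 2) + wh * (t ^ 4 / 4 + t ^ 2) := by positivity
      linarith
    · rw [h.step]
      have h1 := dotProduct_covStep_le (t := t) hN (h.symm hN M) (q (M + 1)) y
      have h2 := hgM q G h M le_rfl ((matA t)ᵀ *ᵥ y)
      have h3 := mul_le_mul_of_nonneg_left (matA_transpose_sq_le t y) hg.le
      have h4 := hN.upper ((matB t)ᵀ *ᵥ y)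
      have h5 := mul_le_mul_of_nonneg_left (matB_transpose_sq_le t y) hwh.le
      have h6 := mul_nonneg hg.le hy
      linarith

lemma norm_pos_le (x : StateIdx → ℝ) : ‖pos (WithLp.toLp 2 x)‖ ^ 2 ≤ x ⬝ᵥ x := by
  rw [EuclideanSpace.real_norm_sq_eq]
  simp only [pos, dotProduct, Fintype.sum_sum_type, ← sq]
  exact le_add_of_nonneg_right (Finset.sum_nonneg fun i _ => sq_nonneg _)

lemma norm_vel_le (x : StateIdx → ℝ) : ‖vel (WithLp.toLp 2 x)‖ ^ 2 ≤ x ⬝ᵥ x := by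
  rw [EuclideanSpace.real_norm_sq_eq]
  simp only [vel, dotProduct, Fintype.sum_sum_type, ← sq]
  exact le_add_of_nonneg_left (Finset.sum_nonneg fun i _ => sq_nonneg _)

lemma dotProduct_self_eq_norm (x : StateIdx → ℝ) :
    x ⬝ᵥ x = ‖pos (WithLp.toLp 2 x)‖ ^ 2 + ‖vel (WithLp.toLp 2 x)‖ ^ 2 := by
  rw [EuclideanSpace.real_norm_sq_eq, EuclideanSpace.real_norm_sq_eq]
  simp [pos, vel, dotProduct, Fintype.sum_sum_type, ← sq]

/-- The filter covariance is bounded above, uniformly along all excited paths: by observability the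
end point `G k y` of the trajectory of `IsCovPath.exists_trajectory` satisfies
`‖G k y‖² ≤ g (y · G k y)`. -/
lemma exists_covariance_le {α Λ r a t Γ wl wh : ℝ} {W : Matrix (Fin 3) (Fin 3) ℝ} (R gl gh : ℝ)
    (N : ℕ) (hα : |α| < 1) (hΛ : Λ < 1) (ha : 0 < a) (ht : 0 < t) (hN : NoiseBounds Γ wl wh W) :
    ∃ g : ℝ, 0 < g ∧ ∀ (T : ℕ) (q z : ℕ → Vec3) (G : ℕ → Matrix StateIdx StateIdx ℝ),
      IsExcitedPath α Λ R r a N T q z → IsCovPath t Γ gl gh W q G →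
      ∀ k ≤ T, ∀ y, y ⬝ᵥ G k *ᵥ y ≤ g * (y ⬝ᵥ y) := by
  have hwh : 0 < wh := hN.wl_pos.trans_le hN.wl_le_wh
  have hΓ := hN.Γ_pos
  obtain ⟨L, K, hK, hobs⟩ := exists_observability (r := r) R N hα hΛ ha ht
  obtain ⟨g₀, hg₀, hsmall⟩ := exists_covariance_le_of_le t gl gh hN L
  set p := (t ^ 4 / 4 + t ^ 2) * wh + Γ with hp
  have hp0 : 0 < p := by positivity
  refine ⟨g₀ + 2 * K ^ 2 * p, by positivity, ?_⟩
  intro T q z G hq hG k hk y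
  have hy := dotProduct_self_nonneg' y
  rcases le_or_gt k L with hkL | hkL
  · refine (hsmall q G hG k hkL y).trans ?_
    gcongr
    have : 0 ≤ 2 * K ^ 2 * p := by positivity
    linarith
  obtain ⟨s, rfl⟩ : ∃ s, k = s + 1 + L := ⟨k - 1 - L, by omega⟩
  obtain ⟨x, hxk, hxm⟩ := hG.exists_trajectory hN (s + 1 + L) y
  set E := y ⬝ᵥ G (s + 1 + L) *ᵥ y with hE
  have hE0 : 0 ≤ E := (hG.symm hN _).2 y
  have hbd : ∀ {u : ℝ}, 0 ≤ u → u ^ 2 ≤ p * E → u ≤ √(p * E) :=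
    fun _ h => Real.le_sqrt_of_sq_le h
  have hd : ∀ m < s + 1 + L, (x (m + 1) - matA t *ᵥ x m) ⬝ᵥ (x (m + 1) - matA t *ᵥ x m)
      ≤ p * E := by
    intro m hm
    refine (hxm m hm).1.trans ?_
    gcongr
    linarith
  have hd₁ : ∀ i < L, ‖pos (WithLp.toLp 2 (x (s + 1 + i + 1)))
      - (pos (WithLp.toLp 2 (x (s + 1 + i))) + t • vel (WithLp.toLp 2 (x (s + 1 + i))))‖
      ≤ √(p * E) := by
    intro i hi
    refine hbd (norm_nonneg _) (le_trans ?_ (hd (s + 1 + i) (by omega)))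
    refine le_trans (le_of_eq ?_) (norm_pos_le _)
    congr 2
    ext j
    simp [pos, vel, matA_mulVec]
  have hd₂ : ∀ i < L, ‖vel (WithLp.toLp 2 (x (s + 1 + i + 1)))
      - vel (WithLp.toLp 2 (x (s + 1 + i)))‖ ≤ √(p * E) := by
    intro i hi
    refine hbd (norm_nonneg _) (le_trans ?_ (hd (s + 1 + i) (by omega)))
    refine le_trans (le_of_eq ?_) (norm_vel_le _)
    congr 2
    ext j
    simp [vel, matA_mulVec]
  have hd₃ : ∀ i ≤ L, |inner ℝ (q (s + 1 + i)) (pos (WithLp.toLp 2 (x (s + 1 + i))))|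
      ≤ √(p * E) := by
    intro i hi
    refine hbd (abs_nonneg _) ?_
    rw [sq_abs, ← outRow_dotProduct]
    have h3 := (hxm (s + i) (by omega)).2
    rw [show s + i + 1 = s + 1 + i by omega] at h3
    refine h3.trans ?_
    gcongr
    rw [hp]
    have : 0 ≤ (t ^ 4 / 4 + t ^ 2) * wh := by positivity
    linarith
  obtain ⟨h1, h2⟩ := hobs T q z hq (s + 1) hk (fun m => pos (WithLp.toLp 2 (x m)))
    (fun m => vel (WithLp.toLp 2 (x m))) (√(p * E)) hd₁ hd₂ hd₃ (Real.sqrt_nonneg _)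
  have hsq : ∀ {u : ℝ}, 0 ≤ u → u ≤ K * √(p * E) → u ^ 2 ≤ K ^ 2 * (p * E) := by
    intro u hu h
    have : u ^ 2 ≤ (K * √(p * E)) ^ 2 := by gcongr
    rwa [mul_pow, Real.sq_sqrt (by positivity)] at this
  have h3 : x (s + 1 + L) ⬝ᵥ x (s + 1 + L) ≤ 2 * K ^ 2 * p * E := by
    rw [dotProduct_self_eq_norm]
    linarith [hsq (norm_nonneg _) h1, hsq (norm_nonneg _) h2]
  have h4 := sq_dotProduct_le y (x (s + 1 + L))
  rw [hxk, ← hE] at h4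
  rw [hxk] at h3
  have h5 : E * E ≤ E * (2 * K ^ 2 * p * (y ⬝ᵥ y)) := by
    nlinarith [mul_le_mul_of_nonneg_left h3 hy]
  have h6 : 0 ≤ g₀ * (y ⬝ᵥ y) := by positivity
  rcases hE0.eq_or_lt with h0 | h0
  · rw [← h0]
    positivity
  · have := le_of_mul_le_mul_left h5 h0
    linarith

/-! ### Pathwise contraction of the estimation error -/

/-- The majorant of the squared estimation error: `c (k+1) = θ (c k + C N k)`. -/
def errBound (θ C : ℝ) (N : ℕ → ℝ) (c₀ : ℝ) : ℕ → ℝ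
  | 0 => c₀
  | k + 1 => θ * (errBound θ C N c₀ k + C * N k)

lemma errBound_nonneg {θ C c₀ : ℝ} {N : ℕ → ℝ} (hθ : 0 ≤ θ) (hC : 0 ≤ C) (hN : ∀ k, 0 ≤ N k)
    (hc : 0 ≤ c₀) : ∀ k, 0 ≤ errBound θ C N c₀ k
  | 0 => hc
  | k + 1 => mul_nonneg hθ (add_nonneg (errBound_nonneg hθ hC hN hc k) (mul_nonneg hC (hN k)))

/-- The size of the noise of one step: `‖a‖² / wl + n² / Γ` for the acceleration `a` and the output
noise `n`. -/
def noiseSize (Γ wl : ℝ) (a : Fin 3 → ℝ) (n : ℝ) : ℝ := (a ⬝ᵥ a) / wl + n ^ 2 / Γ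

/-- The recursion of the estimation error. -/
def errStep (t Γ : ℝ) (W : Matrix (Fin 3) (Fin 3) ℝ) (G : Matrix StateIdx StateIdx ℝ) (q : Vec3)
    (e : StateIdx → ℝ) (a : Fin 3 → ℝ) (n : ℝ) : StateIdx → ℝ :=
  matA t *ᵥ e + matB t *ᵥ a
    - (outRow q ⬝ᵥ (matA t *ᵥ e + matB t *ᵥ a) + n) • kalmanGain Γ (predCov t W G) (outRow q)

lemma dotProduct_errStep (t Γ : ℝ) (W : Matrix (Fin 3) (Fin 3) ℝ)
    (G : Matrix StateIdx StateIdx ℝ) (q : Vec3) (e : StateIdx → ℝ) (a : Fin 3 → ℝ) (n : ℝ)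
    (y : StateIdx → ℝ) : y ⬝ᵥ errStep t Γ W G q e a n
      = (matA t)ᵀ *ᵥ adjMid t Γ W G q y ⬝ᵥ e
        + ((matB t)ᵀ *ᵥ adjMid t Γ W G q y ⬝ᵥ a - n * adjOut t Γ W G q y) := by
  have h1 : ∀ u : StateIdx → ℝ, (matA t)ᵀ *ᵥ u ⬝ᵥ e = u ⬝ᵥ matA t *ᵥ e := fun u => by
    rw [mulVec_transpose, dotProduct_mulVec]
  have h2 : ∀ u : StateIdx → ℝ, (matB t)ᵀ *ᵥ u ⬝ᵥ a = u ⬝ᵥ matB t *ᵥ a := fun u => by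
    rw [mulVec_transpose, dotProduct_mulVec]
  rw [h1, h2, errStep, adjMid, adjUpd, adjOut]
  simp only [dotProduct_sub, dotProduct_add, sub_dotProduct, smul_dotProduct, dotProduct_smul,
    smul_eq_mul, dotProduct_comm y (kalmanGain _ _ _)]
  ring

/-- The contribution of the noise of one step, in units of the covariance after the step. -/
lemma sq_noise_le {t Γ wl wh : ℝ} {W : Matrix (Fin 3) (Fin 3) ℝ} (hN : NoiseBounds Γ wl wh W)
    {G : Matrix StateIdx StateIdx ℝ} (hG : IsSymmNonneg G) (q : Vec3) (a : Fin 3 → ℝ) (n : ℝ)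
    (y : StateIdx → ℝ) :
    ((matB t)ᵀ *ᵥ adjMid t Γ W G q y ⬝ᵥ a - n * adjOut t Γ W G q y) ^ 2
      ≤ noiseSize Γ wl a n * (y ⬝ᵥ covStep t Γ W G q *ᵥ y) := by
  have hΓ := hN.Γ_pos
  have hw := hN.wl_pos
  rw [dotProduct_covStep hN hG]
  have h0 := hG.2 ((matA t)ᵀ *ᵥ adjMid t Γ W G q y)
  set b := (matB t)ᵀ *ᵥ adjMid t Γ W G q y
  set l := adjOut t Γ W G q y
  have h1 := hN.lower b
  have h2 := sq_dotProduct_le b a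
  have ha := dotProduct_self_nonneg' a
  have hb := dotProduct_self_nonneg' b
  have hn : 0 ≤ noiseSize Γ wl a n := by
    unfold noiseSize
    positivity
  have h3 : (b ⬝ᵥ a - n * l) ^ 2 ≤ noiseSize Γ wl a n * (wl * (b ⬝ᵥ b) + Γ * l ^ 2) := by
    -- Cauchy-Schwarz, with the mixed terms compared by the arithmetic-geometric mean inequality
    have e1 : noiseSize Γ wl a n * (wl * (b ⬝ᵥ b) + Γ * l ^ 2)
        = (b ⬝ᵥ b) * (a ⬝ᵥ a) + n ^ 2 * l ^ 2
          + ((a ⬝ᵥ a) * (Γ / wl) * l ^ 2 + n ^ 2 * (wl / Γ) * (b ⬝ᵥ b)) := by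
      unfold noiseSize
      field_simp
      ring
    have e2 : -2 * (b ⬝ᵥ a) * (n * l)
        ≤ (a ⬝ᵥ a) * (Γ / wl) * l ^ 2 + n ^ 2 * (wl / Γ) * (b ⬝ᵥ b) := by
      set X := (a ⬝ᵥ a) * (Γ / wl) * l ^ 2 with hX
      set Y := n ^ 2 * (wl / Γ) * (b ⬝ᵥ b) with hY
      have hX0 : 0 ≤ X := by positivity
      have hY0 : 0 ≤ Y := by positivity
      have hXY : X * Y = (b ⬝ᵥ b) * (a ⬝ᵥ a) * (n * l) ^ 2 := by
        rw [hX, hY]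
        field_simp
      have h4 : ((b ⬝ᵥ a) * (n * l)) ^ 2 ≤ X * Y := by
        rw [hXY, mul_pow]
        gcongr
      refine le_trans (le_abs_self _) (abs_le_of_sq_le_sq ?_ (by positivity))
      nlinarith [sq_nonneg (X - Y)]
    rw [e1]
    nlinarith
  refine h3.trans ?_
  gcongr
  linarith

lemma noiseSize_nonneg {Γ wl : ℝ} (hΓ : 0 < Γ) (hw : 0 < wl) (a : Fin 3 → ℝ) (n : ℝ) :
    0 ≤ noiseSize Γ wl a n := by
  have := dotProduct_self_nonneg' a
  unfold noiseSize
  positivity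

/-- The weighted square of a sum, by convexity. -/
lemma sq_add_le_div_add_div {s x y : ℝ} (hs : 0 < s) (hs1 : s < 1) :
    (x + y) ^ 2 ≤ x ^ 2 / s + y ^ 2 / (1 - s) := by
  have h1 : 0 < 1 - s := by linarith
  rw [div_add_div _ _ hs.ne' h1.ne', le_div_iff₀ (by positivity)]
  nlinarith [sq_nonneg ((1 - s) * x - s * y)]

/-- One step does not increase `sup_y (y·e)² / (y·Gy)`, up to noise. -/
lemma sq_dotProduct_errStep_le {t Γ wl wh : ℝ} {W : Matrix (Fin 3) (Fin 3) ℝ}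
    (hN : NoiseBounds Γ wl wh W) {G : Matrix StateIdx StateIdx ℝ} (hG : IsSymmNonneg G) (q : Vec3)
    {e : StateIdx → ℝ} (a : Fin 3 → ℝ) (n : ℝ) {d : ℝ} (hd : 0 ≤ d)
    (he : ∀ y, (y ⬝ᵥ e) ^ 2 ≤ d * (y ⬝ᵥ G *ᵥ y)) (y : StateIdx → ℝ) :
    (y ⬝ᵥ errStep t Γ W G q e a n) ^ 2
      ≤ 2 * (d + noiseSize Γ wl a n) * (y ⬝ᵥ covStep t Γ W G q *ᵥ y) := by
  have h1 := sq_noise_le (t := t) hN hG q a n y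
  have h2 := he ((matA t)ᵀ *ᵥ adjMid t Γ W G q y)
  have h3 := dotProduct_covStep (t := t) hN hG q y
  have h4 := hN.symm.2 ((matB t)ᵀ *ᵥ adjMid t Γ W G q y)
  have h5 : 0 ≤ Γ * adjOut t Γ W G q y ^ 2 := mul_nonneg hN.Γ_pos.le (sq_nonneg _)
  rw [dotProduct_errStep]
  set E := y ⬝ᵥ covStep t Γ W G q *ᵥ y
  set u := (matA t)ᵀ *ᵥ adjMid t Γ W G q y
  have h6 : d * (u ⬝ᵥ G *ᵥ u) ≤ d * E := mul_le_mul_of_nonneg_left (by linarith) hd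
  refine (add_sq_le).trans ?_
  linarith

/-- Two steps contract `sup_y (y·e)² / (y·Gy)` by a fixed factor, up to noise. -/
lemma sq_dotProduct_errStep_errStep_le {t Γ wl wh δ g s : ℝ} {W : Matrix (Fin 3) (Fin 3) ℝ}
    (hN : NoiseBounds Γ wl wh W) (hδ : 0 < δ) (hg : 0 < g) (hs : 0 < s) (hs1 : s < 1)
    (hsg : s ^ 2 = g / (g + δ)) {G : Matrix StateIdx StateIdx ℝ} (hG : IsSymmNonneg G)
    {q₁ q₂ : Vec3} {y : StateIdx → ℝ}
    (hgain : let G₁ := covStep t Γ W G q₁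
      let y₁ := (matA t)ᵀ *ᵥ adjMid t Γ W G₁ q₂ y
      let y₀ := (matA t)ᵀ *ᵥ adjMid t Γ W G q₁ y₁
      y₀ ⬝ᵥ G *ᵥ y₀ + δ * (y ⬝ᵥ y) ≤ y ⬝ᵥ covStep t Γ W G₁ q₂ *ᵥ y)
    (hupper : y ⬝ᵥ covStep t Γ W (covStep t Γ W G q₁) q₂ *ᵥ y ≤ g * (y ⬝ᵥ y))
    {e : StateIdx → ℝ} (a₁ a₂ : Fin 3 → ℝ) (n₁ n₂ : ℝ) {d : ℝ} (hd : 0 ≤ d)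
    (he : ∀ y, (y ⬝ᵥ e) ^ 2 ≤ d * (y ⬝ᵥ G *ᵥ y)) :
    (y ⬝ᵥ errStep t Γ W (covStep t Γ W G q₁) q₂ (errStep t Γ W G q₁ e a₁ n₁) a₂ n₂) ^ 2
      ≤ (s * d + 2 / (1 - s) * (noiseSize Γ wl a₁ n₁ + noiseSize Γ wl a₂ n₂))
        * (y ⬝ᵥ covStep t Γ W (covStep t Γ W G q₁) q₂ *ᵥ y) := by
  have hΓ := hN.Γ_pos
  set G₁ := covStep t Γ W G q₁ with hG₁def
  have hG₁ : IsSymmNonneg G₁ := isSymmNonneg_covStep hN hG q₁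
  have h1 := sq_noise_le (t := t) hN hG₁ q₂ a₂ n₂ y
  have hE₂ := dotProduct_covStep (t := t) hN hG₁ q₂ y
  have hp₂ := hN.symm.2 ((matB t)ᵀ *ᵥ adjMid t Γ W G₁ q₂ y)
  have hl₂ : 0 ≤ Γ * adjOut t Γ W G₁ q₂ y ^ 2 := mul_nonneg hΓ.le (sq_nonneg _)
  rw [dotProduct_errStep, dotProduct_errStep]
  dsimp only at hgain
  set y₁ := (matA t)ᵀ *ᵥ adjMid t Γ W G₁ q₂ y with hy₁
  have h2 := sq_noise_le (t := t) hN hG q₁ a₁ n₁ y₁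
  set y₀ := (matA t)ᵀ *ᵥ adjMid t Γ W G q₁ y₁ with hy₀
  set ν₁ := (matB t)ᵀ *ᵥ adjMid t Γ W G q₁ y₁ ⬝ᵥ a₁ - n₁ * adjOut t Γ W G q₁ y₁
  set ν₂ := (matB t)ᵀ *ᵥ adjMid t Γ W G₁ q₂ y ⬝ᵥ a₂ - n₂ * adjOut t Γ W G₁ q₂ y
  set E := y ⬝ᵥ covStep t Γ W G₁ q₂ *ᵥ y
  set E₀ := y₀ ⬝ᵥ G *ᵥ y₀
  have hN₁ := noiseSize_nonneg hΓ hN.wl_pos a₁ n₁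
  have hN₂ := noiseSize_nonneg hΓ hN.wl_pos a₂ n₂
  set N₁ := noiseSize Γ wl a₁ n₁
  set N₂ := noiseSize Γ wl a₂ n₂
  have hE₁E : y₁ ⬝ᵥ G₁ *ᵥ y₁ ≤ E := by linarith
  have h2' : ν₁ ^ 2 ≤ N₁ * E := h2.trans (mul_le_mul_of_nonneg_left hE₁E hN₁)
  have h3 : E₀ ≤ s ^ 2 * E := by
    rw [hsg, div_mul_eq_mul_div, le_div_iff₀ (by positivity)]
    have hE₀ : 0 ≤ E₀ := hG.2 y₀
    have e1 : g * (E₀ + δ * (y ⬝ᵥ y)) ≤ g * E := mul_le_mul_of_nonneg_left hgain hg.le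
    have e2 : δ * E ≤ δ * (g * (y ⬝ᵥ y)) := mul_le_mul_of_nonneg_left hupper hδ.le
    have e3 : δ * E₀ ≤ δ * E := by
      have := dotProduct_self_nonneg' y
      have : 0 ≤ δ * (y ⬝ᵥ y) := by positivity
      gcongr
      linarith
    nlinarith
  have h4 : (y₀ ⬝ᵥ e) ^ 2 ≤ s ^ 2 * (d * E) :=
    (he y₀).trans ((mul_le_mul_of_nonneg_left h3 hd).trans_eq (by ring))
  have hs' : 0 < 1 - s := by linarith
  calc (y₀ ⬝ᵥ e + ν₁ + ν₂) ^ 2 = (y₀ ⬝ᵥ e + (ν₁ + ν₂)) ^ 2 := by ring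
    _ ≤ (y₀ ⬝ᵥ e) ^ 2 / s + (ν₁ + ν₂) ^ 2 / (1 - s) := sq_add_le_div_add_div hs hs1
    _ ≤ s ^ 2 * (d * E) / s + 2 * (N₁ * E + N₂ * E) / (1 - s) := by
      gcongr
      exact add_sq_le.trans (by linarith)
    _ = _ := by
      field_simp

/-- The estimation error along an excited path contracts exponentially, up to the accumulated
noise. -/
lemma exists_errBound {α Λ r a t Γ wl wh gl : ℝ} {W : Matrix (Fin 3) (Fin 3) ℝ} (R gh : ℝ)
    (N : ℕ) (hα : |α| < 1) (hΛ : Λ < 1) (ha : 0 < a) (ht : 0 < t) (hN : NoiseBounds Γ wl wh W)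
    (hgl : 0 < gl) :
    ∃ g θ C K : ℝ, 0 < g ∧ 0 < θ ∧ θ < 1 ∧ 0 < C ∧ 0 < K ∧
      ∀ (T : ℕ) (q z : ℕ → Vec3) (G : ℕ → Matrix StateIdx StateIdx ℝ) (e : ℕ → StateIdx → ℝ)
        (u : ℕ → Fin 3 → ℝ) (n : ℕ → ℝ),
        IsExcitedPath α Λ R r a N T q z → IsCovPath t Γ gl gh W q G →
        (∀ k, e (k + 1) = errStep t Γ W (G k) (q (k + 1)) (e k) (u k) (n k)) →
        ∀ k ≤ T, e k ⬝ᵥ e k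
          ≤ g * errBound θ C (fun m => noiseSize Γ wl (u m) (n m)) (K * (e 0 ⬝ᵥ e 0)) k := by
  obtain ⟨g, hg, hup⟩ := exists_covariance_le (r := r) R gl gh N hα hΛ ha ht hN
  obtain ⟨δ, hδ, hgain⟩ := exists_two_step_gain ht hN (relBound Λ R r)
  -- the rate over two steps is `s = θ²`, where `s²` is the contraction factor of the covariances
  set s := √(g / (g + δ)) with hs
  have hsg : s ^ 2 = g / (g + δ) := Real.sq_sqrt (by positivity)
  have hs0 : 0 < s := Real.sqrt_pos.2 (by positivity)
  have hs1 : s < 1 := by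
    rw [hs, Real.sqrt_lt' one_pos, one_pow, div_lt_one (by positivity)]
    linarith
  have hs' : 0 < 1 - s := by linarith
  set θ := √s with hθ
  have hθs : θ ^ 2 = s := Real.sq_sqrt hs0.le
  have hθ0 : 0 < θ := Real.sqrt_pos.2 hs0
  have hθ1 : θ < 1 := by rwa [hθ, Real.sqrt_lt' one_pos, one_pow]
  set C := 2 / (1 - s) / s with hC
  have hC0 : 0 < C := by positivity
  have hCs : C * s = 2 / (1 - s) := by
    rw [hC]
    field_simp
  have hsθ : s ≤ θ := by
    rw [← hθs]
    nlinarith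
  have hCθ : 2 / (1 - s) ≤ C * θ := by
    rw [← hCs]
    gcongr
  have h2s : 2 ≤ 2 / (1 - s) := by
    rw [le_div_iff₀ hs']
    linarith
  refine ⟨g, θ, C, 2 / (gl * θ), hg, hθ0, hθ1, hC0, by positivity, ?_⟩
  intro T q z G e u n hq hG he
  set ν := fun m => noiseSize Γ wl (u m) (n m) with hν
  have hν0 : ∀ m, 0 ≤ ν m := fun m => noiseSize_nonneg hN.Γ_pos hN.wl_pos _ _
  have he0 := dotProduct_self_nonneg' (e 0)
  have hK0 : 0 ≤ 2 / (gl * θ) * (e 0 ⬝ᵥ e 0) := by positivity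
  set c := errBound θ C ν (2 / (gl * θ) * (e 0 ⬝ᵥ e 0)) with hc
  have hc0 : ∀ k, 0 ≤ c k := errBound_nonneg hθ0.le hC0.le hν0 hK0
  have hcs : ∀ k, c (k + 1) = θ * (c k + C * ν k) := fun k => rfl
  have hqb := hq.norm_le hα.le hΛ
  have hinit : ∀ y : StateIdx → ℝ, (y ⬝ᵥ e 0) ^ 2 ≤ (e 0 ⬝ᵥ e 0) / gl * (y ⬝ᵥ G 0 *ᵥ y) := by
    intro y
    refine (sq_dotProduct_le y (e 0)).trans ?_
    have := mul_le_mul_of_nonneg_left (hG.lower_init y)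
      (show 0 ≤ (e 0 ⬝ᵥ e 0) / gl by positivity)
    refine le_trans (le_of_eq ?_) this
    field_simp
  have hmono : ∀ {k : ℕ} {d : ℝ}, d ≤ c k → ∀ {x : ℝ} (y : StateIdx → ℝ),
      x ≤ d * (y ⬝ᵥ G k *ᵥ y) → x ≤ c k * (y ⬝ᵥ G k *ᵥ y) := fun hd x y hx =>
    hx.trans (mul_le_mul_of_nonneg_right hd ((hG.symm hN _).2 y))
  have hd0 : (e 0 ⬝ᵥ e 0) / gl ≤ θ * c 0 / 2 := by
    change _ ≤ θ * (2 / (gl * θ) * (e 0 ⬝ᵥ e 0)) / 2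
    field_simp
    exact le_rfl
  have key : ∀ k, (k ≤ T → ∀ y, (y ⬝ᵥ e k) ^ 2 ≤ c k * (y ⬝ᵥ G k *ᵥ y)) ∧
      (k + 1 ≤ T → ∀ y, (y ⬝ᵥ e (k + 1)) ^ 2 ≤ c (k + 1) * (y ⬝ᵥ G (k + 1) *ᵥ y)) := by
    intro k
    induction k with
    | zero =>
      refine ⟨fun _ y => hmono ?_ y (hinit y), fun _ y =>
        hmono (d := 2 * ((e 0 ⬝ᵥ e 0) / gl + ν 0)) ?_ y ?_⟩
      · have := hc0 0
        nlinarith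
      · rw [hcs]
        have := mul_le_mul_of_nonneg_right (h2s.trans hCθ) (hν0 0)
        linarith
      · rw [he, hG.step]
        exact sq_dotProduct_errStep_le hN hG.symm_init _ _ _ (by positivity) hinit y
    | succ k ih =>
      refine ⟨ih.2, fun hk y => ?_⟩
      have h1 := hgain (G k) (q (k + 1)) (q (k + 1 + 1)) y (hG.symm hN k) (hqb _ (by omega))
        (hqb _ hk)
      have h2 := hup T q z G hq hG (k + 1 + 1) hk y
      rw [hG.step, hG.step] at h2
      have h3 := sq_dotProduct_errStep_errStep_le hN hδ hg hs0 hs1 hsg (hG.symm hN k) h1 h2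
        (u k) (u (k + 1)) (n k) (n (k + 1)) (hc0 k) (ih.1 (by omega))
      refine hmono ?_ y (d := s * c k + 2 / (1 - s) * (ν k + ν (k + 1))) ?_
      · rw [hcs, hcs]
        have e1 := mul_le_mul_of_nonneg_right hCθ (hν0 (k + 1))
        have e2 : θ * (θ * (c k + C * ν k) + C * ν (k + 1))
            = s * c k + 2 / (1 - s) * ν k + C * θ * ν (k + 1) := by
          rw [← hCs, ← hθs]
          ring
        rw [e2]
        linarith
      · rw [he, he, hG.step (k + 1), hG.step k]
        exact h3
  intro k hk
  have h1 := (key k).1 hk (e k)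
  have h2 := mul_le_mul_of_nonneg_left (hup T q z G hq hG k hk (e k)) (hc0 k)
  rcases (dotProduct_self_nonneg' (e k)).eq_or_lt with h0 | h0
  · rw [← h0]
    exact mul_nonneg hg.le (hc0 k)
  · refine le_of_mul_le_mul_left ?_ h0
    nlinarith

/-! ### The closed loop along one outcome -/

lemma pos_sub (X Y : State) : pos (X - Y) = pos X - pos Y := rfl

lemma vel_sub (X Y : State) : vel (X - Y) = vel X - vel Y := rfl

lemma motion_ofLp (t : ℝ) (X : State) (u : Vec3) :
    (motion t X u).ofLp = matA t *ᵥ X.ofLp + matB t *ᵥ u.ofLp := rfl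

lemma pos_motion (t : ℝ) (X : State) (u : Vec3) :
    pos (motion t X u) = pos X + t • vel X + (t ^ 2 / 2) • u := by
  ext i
  have : motion t X u (Sum.inl i) = (matA t *ᵥ X.ofLp + matB t *ᵥ u.ofLp) (Sum.inl i) := rfl
  simp [pos, vel, this, matA_mulVec, matB_mulVec]

/-- The control law replaces the velocity of the guardian by the estimated velocity of the target
and adds the feedback and the encirclement motion. -/
lemma pos_motion_ctrlInput {t : ℝ} (ht : 0 < t) (α s g : ℝ) (X Xhat : State) (ζ ζ' : Vec3) :
    pos (motion t X (ctrlInput t α s g X Xhat ζ ζ'))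
      = pos X + ((α - 1) * g) • (pos X - pos Xhat) + s • (ζ' - α • ζ) + t • vel Xhat := by
  rw [pos_motion, ctrlInput]
  simp only [smul_add, smul_smul]
  have h1 : t ^ 2 / 2 * (2 / t ^ 2) = 1 := by field_simp
  have h2 : t ^ 2 / 2 * (2 / t) = t := by field_simp
  simp only [← mul_assoc, h1, h2]
  module

lemma satur_mem {β U : ℝ} (hβ : 1 < β) (hU : 0 < U) (d₁ d₂ : ℝ) :
    β⁻¹ ≤ satur β U d₁ d₂ ∧ satur β U d₁ d₂ ≤ 1 := by
  have hm : 0 < max U ((d₁ + d₂) / 2) := hU.trans_le (le_max_left _ _)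
  have h1 : U * (β - 1) / max U ((d₁ + d₂) / 2) ≤ β - 1 := by
    rw [div_le_iff₀ hm, mul_comm]
    exact mul_le_mul_of_nonneg_left (le_max_left _ _) (by linarith)
  have h2 : 0 ≤ U * (β - 1) / max U ((d₁ + d₂) / 2) :=
    div_nonneg (mul_nonneg hU.le (by linarith)) hm.le
  have hβ0 : 0 < β := by linarith
  rw [satur, one_div]
  constructor
  · exact le_mul_of_one_le_right (by positivity) (by linarith)
  · rw [inv_mul_le_iff₀ hβ0]
    linarith

namespace Params.Admissible

variable {c : Params} (hc : c.Admissible)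

include hc

lemma contr_pos : 0 < c.contr :=
  (inv_pos.2 (zero_lt_one.trans hc.β_gt)).trans_le (le_max_left _ _)

lemma contr_lt_one : c.contr < 1 := by
  have h0 : 0 < c.β⁻¹ := inv_pos.2 (zero_lt_one.trans hc.β_gt)
  exact max_lt (inv_lt_one_of_one_lt₀ hc.β_gt) (by linarith)

lemma abs_α_lt_one : |c.α| < 1 := by
  have h1 := hc.α_gt
  have h2 := inv_lt_one_of_one_lt₀ hc.β_gt
  rw [abs_of_neg hc.α_neg]
  linarith

/-- The saturated feedback contracts by the factor `β̃⁻¹`. -/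
lemma abs_feedback_le (d₁ d₂ : ℝ) : |1 + (c.α - 1) * satur c.β c.U d₁ d₂| ≤ c.contr := by
  obtain ⟨h1, h2⟩ := satur_mem hc.β_gt hc.U_pos d₁ d₂
  have h3 := hc.α_gt
  have h4 := hc.α_neg
  have h5 : c.β⁻¹ ≤ c.contr := le_max_left _ _
  have h6 : 1 - c.β⁻¹ ≤ c.contr := le_max_right _ _
  have h7 : 0 < c.β⁻¹ := inv_pos.2 (zero_lt_one.trans hc.β_gt)
  rw [abs_le]
  constructor <;> nlinarith

lemma posSemidef_W (i : Fin 2) : (c.W i).PosSemidef := by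
  have h := (hc.W_lower i).add ((PosSemidef.one (n := Fin 3) (R := ℝ)).smul (hc.wlo_pos i).le)
  simpa using h

lemma W_form_le (i : Fin 2) (b : Fin 3 → ℝ) : b ⬝ᵥ c.W i *ᵥ b ≤ c.whi i * (b ⬝ᵥ b) := by
  have h := (hc.W_upper i).dotProduct_mulVec_nonneg b
  simp only [star_trivial, sub_mulVec, smul_mulVec, one_mulVec, dotProduct_sub, dotProduct_smul,
    smul_eq_mul] at h
  linarith

lemma le_W_form (i : Fin 2) (b : Fin 3 → ℝ) : c.wlo i * (b ⬝ᵥ b) ≤ b ⬝ᵥ c.W i *ᵥ b := by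
  have h := (hc.W_lower i).dotProduct_mulVec_nonneg b
  simp only [star_trivial, sub_mulVec, smul_mulVec, one_mulVec, dotProduct_sub, dotProduct_smul,
    smul_eq_mul] at h
  linarith

lemma outVar_pos : 0 < c.outVar := by
  have h0 : (0 : ℝ) < c.σ 0 := hc.σ_pos 0
  have h1 : (0 : ℝ) < c.σ 1 := hc.σ_pos 1
  unfold Params.outVar
  positivity

lemma noiseBounds : NoiseBounds c.outVar (c.γ * c.wlo 0 + (1 - c.γ) * c.wlo 1) c.accCovUpper
    c.accCov := by
  have hγ := hc.γ_pos
  have hγ' : 0 ≤ 1 - c.γ := by linarith [hc.γ_le]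
  have hform : ∀ b : Fin 3 → ℝ, b ⬝ᵥ c.accCov *ᵥ b
      = c.γ * (b ⬝ᵥ c.W 0 *ᵥ b) + (1 - c.γ) * (b ⬝ᵥ c.W 1 *ᵥ b) := by
    intro b
    simp [Params.accCov, add_mulVec, smul_mulVec]
  refine ⟨hc.outVar_pos, ?_, ?_, fun b => ?_, fun b => ?_⟩
  · exact add_pos_of_pos_of_nonneg (mul_pos hγ (hc.wlo_pos 0))
      (mul_nonneg hγ' (hc.wlo_pos 1).le)
  · exact isSymmNonneg_of_posSemidef
      (((hc.posSemidef_W 0).smul hγ.le).add ((hc.posSemidef_W 1).smul hγ'))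
  · rw [hform]
    have := mul_le_mul_of_nonneg_left (hc.le_W_form 0 b) hγ.le
    have := mul_le_mul_of_nonneg_left (hc.le_W_form 1 b) hγ'
    linarith
  · rw [hform, Params.accCovUpper]
    have := mul_le_mul_of_nonneg_left (hc.W_form_le 0 b) hγ.le
    have := mul_le_mul_of_nonneg_left (hc.W_form_le 1 b) hγ'
    linarith

end Params.Admissible

/-- The noise `(η₂ - η₁) / 2` of the linear output. -/
def Processes.outNoise {Ω : Type*} (S : Processes Ω) (k : ℕ) (ω : Ω) : ℝ :=
  (S.η 1 (k + 1) ω - S.η 0 (k + 1) ω) / 2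

/-- The output is linear in the state of the target: the squared norms cancel. -/
lemma Processes.output_eq {Ω : Type*} (S : Processes Ω) (k : ℕ) (ω : Ω) : S.output (k + 1) ω
    = outRow (S.q₁₂ (k + 1) ω) ⬝ᵥ (S.T (k + 1) ω).ofLp + S.outNoise k ω := by
  rw [outRow_dotProduct]
  simp only [Processes.output, linOutput, Processes.meas, Processes.q₁₂, Processes.outNoise,
    norm_sub_sq_real, inner_sub_left]
  ring

namespace IsHostilePhase

variable {c : Params} {Ω : Type*} [MeasurableSpace Ω] {P : Measure Ω}
  {ℱ : Filtration ℕ ‹MeasurableSpace Ω›} {τ : Ω → WithTop ℕ} {S : Processes Ω}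

lemma isExcitedPath (h : IsHostilePhase c P ℱ τ S) (hc : c.Admissible) {ω : Ω} {T : ℕ}
    (hT : (T : WithTop ℕ) ≤ τ ω) : IsExcitedPath c.α c.contr c.R c.rbar c.alo c.N T
      (fun k => S.q₁₂ k ω) (fun k => S.ζ c k ω) := by
  refine ⟨h.q_init ω, fun k => h.ζ_bound k ω, fun k y => ?_, fun k hk => ?_⟩
  · have h1 := (h.ζ_lower k ω).dotProduct_mulVec_nonneg y.ofLp
    have h2 : ∀ m, y.ofLp ⬝ᵥ vecMulVec (S.ζ c m ω).ofLp (S.ζ c m ω).ofLp *ᵥ y.ofLp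
        = inner ℝ (S.ζ c m ω) y ^ 2 := by
      intro m
      rw [vecMulVec_mulVec]
      simp [PiLp.inner_apply, dotProduct, sq, mul_comm]
      simp only [← mul_assoc, ← Finset.sum_mul]
    have h3 : y.ofLp ⬝ᵥ y.ofLp = ‖y‖ ^ 2 := by
      rw [EuclideanSpace.real_norm_sq_eq]
      simp [dotProduct, sq]
    simp only [star_trivial, sub_mulVec, smul_mulVec, one_mulVec, dotProduct_sub, dotProduct_smul,
      smul_eq_mul, sum_mulVec, dotProduct_sum, h2, h3] at h1
    linarith
  · have hk' : (k : WithTop ℕ) < τ ω := lt_of_lt_of_le (by exact_mod_cast hk) hT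
    refine ⟨1 + (c.α - 1) * S.saturVal c k ω, hc.abs_feedback_le _ _, ?_⟩
    simp only [Processes.q₁₂]
    rw [h.X_step, h.X_step, h.u_law 0 k ω hk', h.u_law 1 k ω hk', pos_motion_ctrlInput hc.t_pos,
      pos_motion_ctrlInput hc.t_pos]
    have e0 : guardSign 0 = -1 := by simp [guardSign]
    have e1 : guardSign 1 = 1 := by simp [guardSign]
    rw [e0, e1]
    module

lemma isCovPath (h : IsHostilePhase c P ℱ τ S) (hc : c.Admissible) (ω : Ω) :
    IsCovPath c.t c.outVar c.glo c.ghi c.accCov (fun k => S.q₁₂ k ω) (fun k => S.G k ω) := by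
  refine ⟨?_, fun y => ?_, fun y => ?_, fun k => h.G_step k ω⟩
  · have h1 := (h.G_lower ω).add
      ((PosSemidef.one (n := StateIdx) (R := ℝ)).smul hc.glo_pos.le)
    exact isSymmNonneg_of_posSemidef (by simpa using h1)
  · have h1 := (h.G_lower ω).dotProduct_mulVec_nonneg y
    simp only [star_trivial, sub_mulVec, smul_mulVec, one_mulVec, dotProduct_sub, dotProduct_smul,
      smul_eq_mul] at h1
    linarith
  · have h1 := (h.G_upper ω).dotProduct_mulVec_nonneg y
    simp only [star_trivial, sub_mulVec, smul_mulVec, one_mulVec, dotProduct_sub, dotProduct_smul,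
      smul_eq_mul] at h1
    linarith

lemma estErr_step (h : IsHostilePhase c P ℱ τ S) (k : ℕ) (ω : Ω) :
    (S.estErr (k + 1) ω).ofLp = errStep c.t c.outVar c.accCov (S.G k ω) (S.q₁₂ (k + 1) ω)
      (S.estErr k ω).ofLp (S.a k ω).ofLp (S.outNoise k ω) := by
  have h1 : (S.That (k + 1) ω).ofLp = matA c.t *ᵥ (S.That k ω).ofLp
      + (S.output (k + 1) ω - outRow (S.q₁₂ (k + 1) ω) ⬝ᵥ (matA c.t).mulVec (S.That k ω).ofLp)
      • S.gain c k ω := by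
    rw [h.That_step]
    rfl
  have h2 : (S.estErr k ω).ofLp = (S.T k ω).ofLp - (S.That k ω).ofLp := rfl
  have h3 : (S.estErr (k + 1) ω).ofLp = (S.T (k + 1) ω).ofLp - (S.That (k + 1) ω).ofLp := rfl
  rw [h3, h1, S.output_eq, h.T_step, motion_ofLp, errStep, h2, Processes.gain, Processes.Gpred,
    mulVec_sub]
  have h4 : ∀ C u v w : StateIdx → ℝ, C ⬝ᵥ (u - v + w) = C ⬝ᵥ (u + w) - C ⬝ᵥ v := by
    intro C u v w
    simp only [dotProduct_add, dotProduct_sub]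
    ring
  rw [h4]
  module

/-- The encirclement error obeys a contracting recursion, driven by the estimation error and the
acceleration of the target. -/
lemma encErr_step (h : IsHostilePhase c P ℱ τ S) (hc : c.Admissible) {k : ℕ} {ω : Ω}
    (hk : (k : WithTop ℕ) < τ ω) : S.encErr (k + 1) ω
      = (1 + (c.α - 1) * S.saturVal c k ω) • S.encErr k ω
        + ((2 * ((c.α - 1) * S.saturVal c k ω)) • pos (S.estErr k ω)
          - (2 * c.t) • vel (S.estErr k ω)) - (c.t ^ 2) • S.a k ω := by
  simp only [Processes.encErr, Processes.estErr]
  rw [h.X_step, h.X_step, h.u_law 0 k ω hk, h.u_law 1 k ω hk, pos_motion_ctrlInput hc.t_pos,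
    pos_motion_ctrlInput hc.t_pos, h.T_step, pos_motion, pos_sub, vel_sub]
  have e0 : guardSign 0 = -1 := by simp [guardSign]
  have e1 : guardSign 1 = 1 := by simp [guardSign]
  rw [e0, e1]
  module

end IsHostilePhase

/-! ### Moments of the noises -/

lemma integrable_sq_mixtureLaw (γ : ℝ) (W₁ W₂ : Matrix (Fin 3) (Fin 3) ℝ) :
    Integrable (fun x : Vec3 => ‖x‖ ^ 2) (mixtureLaw γ W₁ W₂) := by
  have h : ∀ W : Matrix (Fin 3) (Fin 3) ℝ,
      Integrable (fun x : Vec3 => ‖x‖ ^ 2) (multivariateGaussian 0 W) := fun W =>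
    (memLp_two_iff_integrable_sq_norm (by fun_prop)).1 (IsGaussian.memLp_two_id)
  exact ((h W₁).smul_measure ENNReal.ofReal_ne_top).add_measure
    ((h W₂).smul_measure ENNReal.ofReal_ne_top)

lemma integral_id_mixtureLaw (γ : ℝ) (W₁ W₂ : Matrix (Fin 3) (Fin 3) ℝ) :
    ∫ x : Vec3, x ∂mixtureLaw γ W₁ W₂ = 0 := by
  have h : ∀ W : Matrix (Fin 3) (Fin 3) ℝ,
      Integrable (fun x : Vec3 => x) (multivariateGaussian 0 W) := fun W =>
    IsGaussian.integrable_fun_id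
  rw [mixtureLaw, integral_add_measure ((h W₁).smul_measure ENNReal.ofReal_ne_top)
    ((h W₂).smul_measure ENNReal.ofReal_ne_top), integral_smul_measure, integral_smul_measure,
    integral_id_multivariateGaussian, integral_id_multivariateGaussian]
  simp

lemma integral_sq_multivariateGaussian {W : Matrix (Fin 3) (Fin 3) ℝ} (hW : W.PosSemidef) :
    ∫ x : Vec3, ‖x‖ ^ 2 ∂multivariateGaussian 0 W = W.trace := by
  have hm : ∀ i, MemLp (fun x : Vec3 => x i) 2 (multivariateGaussian 0 W) := fun i =>
    (EuclideanSpace.proj (𝕜 := ℝ) i).comp_memLp' (IsGaussian.memLp_two_id)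
  simp_rw [EuclideanSpace.real_norm_sq_eq]
  rw [integral_finsetSum _ fun i _ => (hm i).integrable_sq, trace]
  refine Finset.sum_congr rfl fun i _ => ?_
  rw [diag_apply, ← variance_eval_multivariateGaussian (μ := 0) hW i,
    variance_of_integral_eq_zero (by fun_prop)]
  have h := (EuclideanSpace.proj (𝕜 := ℝ) i).integral_comp_comm
    (IsGaussian.integrable_fun_id (μ := multivariateGaussian (0 : Vec3) W))
  rw [integral_id_multivariateGaussian] at h
  simpa using h

lemma integral_sq_mixtureLaw_le {c : Params} (hc : c.Admissible) :
    ∫ x : Vec3, ‖x‖ ^ 2 ∂mixtureLaw c.γ (c.W 0) (c.W 1) ≤ 3 * c.accCovUpper := by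
  have h : ∀ W : Matrix (Fin 3) (Fin 3) ℝ,
      Integrable (fun x : Vec3 => ‖x‖ ^ 2) (multivariateGaussian 0 W) := fun W =>
    (memLp_two_iff_integrable_sq_norm (by fun_prop)).1 (IsGaussian.memLp_two_id)
  have htr : ∀ i, (c.W i).trace ≤ 3 * c.whi i := by
    intro i
    have h1 := fun j => (hc.W_upper i).diag_nonneg (i := j)
    simp only [Matrix.sub_apply, Matrix.smul_apply, one_apply_eq, smul_eq_mul, mul_one] at h1
    rw [trace, Fin.sum_univ_three]
    simp only [diag_apply]
    linarith [h1 0, h1 1, h1 2]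
  have hγ' : 0 ≤ 1 - c.γ := by linarith [hc.γ_le]
  rw [mixtureLaw, integral_add_measure ((h _).smul_measure ENNReal.ofReal_ne_top)
    ((h _).smul_measure ENNReal.ofReal_ne_top), integral_smul_measure, integral_smul_measure,
    integral_sq_multivariateGaussian (hc.posSemidef_W 0),
    integral_sq_multivariateGaussian (hc.posSemidef_W 1), ENNReal.toReal_ofReal hc.γ_pos.le,
    ENNReal.toReal_ofReal hγ', smul_eq_mul, smul_eq_mul, Params.accCovUpper]
  have := mul_le_mul_of_nonneg_left (htr 0) hc.γ_pos.le
  have := mul_le_mul_of_nonneg_left (htr 1) hγ'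
  linarith

namespace IsHostilePhase

variable {c : Params} {Ω : Type*} [mΩ : MeasurableSpace Ω] {P : Measure Ω}
  {ℱ : Filtration ℕ ‹MeasurableSpace Ω›} {τ : Ω → WithTop ℕ} {S : Processes Ω}

lemma measurable_a (h : IsHostilePhase c P ℱ τ S) (k : ℕ) : Measurable (S.a k) :=
  (h.a_meas k).mono (ℱ.le _) le_rfl

lemma memLp_a (h : IsHostilePhase c P ℱ τ S) (k : ℕ) : MemLp (S.a k) 2 P := by
  have h1 := integrable_sq_mixtureLaw c.γ (c.W 0) (c.W 1)
  rw [← h.a_law k, integrable_map_measure (by fun_prop) (h.measurable_a k).aemeasurable] at h1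
  exact (memLp_two_iff_integrable_sq_norm (h.measurable_a k).aestronglyMeasurable).2 h1

lemma integral_a (h : IsHostilePhase c P ℱ τ S) (k : ℕ) : ∫ ω, S.a k ω ∂P = 0 := by
  have h1 := integral_id_mixtureLaw c.γ (c.W 0) (c.W 1)
  rwa [← h.a_law k, integral_map (h.measurable_a k).aemeasurable (by fun_prop)] at h1

lemma integral_sq_a_le (h : IsHostilePhase c P ℱ τ S) (hc : c.Admissible) (k : ℕ) :
    ∫ ω, ‖S.a k ω‖ ^ 2 ∂P ≤ 3 * c.accCovUpper := by
  have h1 := integral_sq_mixtureLaw_le hc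
  rwa [← h.a_law k, integral_map (h.measurable_a k).aemeasurable (by fun_prop)] at h1

lemma measurable_η (h : IsHostilePhase c P ℱ τ S) (i : Fin 2) (k : ℕ) :
    Measurable (S.η i (k + 1)) :=
  (h.η_meas i k).mono (ℱ.le _) le_rfl

lemma memLp_η (h : IsHostilePhase c P ℱ τ S) (i : Fin 2) (k : ℕ) :
    MemLp (S.η i (k + 1)) 2 P := by
  have h1 := memLp_id_gaussianReal' (μ := 0) (v := c.σ i) 2 (by simp)
  rw [← h.η_law i k] at h1
  exact (memLp_map_measure_iff (by fun_prop) (h.measurable_η i k).aemeasurable).1 h1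

lemma integral_sq_η (h : IsHostilePhase c P ℱ τ S) (i : Fin 2) (k : ℕ) :
    ∫ ω, S.η i (k + 1) ω ^ 2 ∂P = c.σ i := by
  have h1 : ∫ x, x ^ 2 ∂gaussianReal 0 (c.σ i) = c.σ i := by
    have h2 := variance_fun_id_gaussianReal (μ := 0) (v := c.σ i)
    rwa [variance_of_integral_eq_zero (by fun_prop) integral_id_gaussianReal] at h2
  rwa [← h.η_law i k, integral_map (h.measurable_η i k).aemeasurable (by fun_prop)] at h1

lemma memLp_outNoise (h : IsHostilePhase c P ℱ τ S) (k : ℕ) : MemLp (S.outNoise k) 2 P := by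
  have := ((h.memLp_η 1 k).sub (h.memLp_η 0 k)).const_mul (1 / 2)
  refine this.ae_eq (Filter.Eventually.of_forall fun ω => ?_)
  simp only [Processes.outNoise, Pi.sub_apply]
  ring

lemma integral_sq_outNoise_le (h : IsHostilePhase c P ℱ τ S) (k : ℕ) :
    ∫ ω, S.outNoise k ω ^ 2 ∂P ≤ 2 * c.outVar := by
  have h0 := (h.memLp_η 0 k).integrable_sq
  have h1 := (h.memLp_η 1 k).integrable_sq
  calc ∫ ω, S.outNoise k ω ^ 2 ∂P
      ≤ ∫ ω, (1 / 2) * (S.η 1 (k + 1) ω ^ 2 + S.η 0 (k + 1) ω ^ 2) ∂P := by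
        refine integral_mono (h.memLp_outNoise k).integrable_sq ((h1.add h0).const_mul _)
          fun ω => ?_
        simp only [Processes.outNoise]
        nlinarith [sq_nonneg (S.η 1 (k + 1) ω + S.η 0 (k + 1) ω)]
    _ = 2 * c.outVar := by
        rw [integral_const_mul, integral_add h1 h0, h.integral_sq_η, h.integral_sq_η,
          Params.outVar]
        ring

/-- The acceleration `a k` is uncorrelated with everything known at step `k`. -/
lemma integral_inner_a [IsProbabilityMeasure P] (h : IsHostilePhase c P ℱ τ S) (k : ℕ)
    {F : Ω → Vec3} (hF : Measurable[ℱ k] F) (hFi : Integrable F P) :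
    Integrable (fun ω => inner ℝ (F ω) (S.a k ω)) P ∧ ∫ ω, inner ℝ (F ω) (S.a k ω) ∂P = 0 := by
  have ha : Integrable (S.a k) P := (h.memLp_a k).integrable one_le_two
  have hind : IndepFun F (S.a k) P := by
    rw [IndepFun_iff_Indep]
    refine indep_of_indep_of_le_left (indep_of_indep_of_le_right (h.noise_indep_past k).symm ?_)
      hF.comap_le
    have : S.a k = Prod.fst ∘ fun ω => (S.a k ω, S.η 0 (k + 1) ω, S.η 1 (k + 1) ω) := rfl
    conv_lhs => rw [this, ← MeasurableSpace.comap_comp]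
    exact MeasurableSpace.comap_mono measurable_fst.comap_le
  refine ⟨hind.integrable_bilin hFi ha (innerSL ℝ), ?_⟩
  have h1 := hind.integral_bilin hFi ha (innerSL ℝ)
  rw [h.integral_a, map_zero] at h1
  exact h1

end IsHostilePhase

/-! ### Measurability before the stopping time -/

section Measurability

variable {Ω : Type*} [MeasurableSpace Ω]

lemma measurable_euclidean {ι : Type*} [Fintype ι] {f : Ω → EuclideanSpace ℝ ι}
    (h : ∀ i, Measurable fun ω => f ω i) : Measurable f :=
  (WithLp.measurable_toLp 2 (ι → ℝ)).comp (measurable_pi_lambda _ h)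

@[fun_prop]
lemma measurable_pos {X : Ω → State} (hX : Measurable X) : Measurable fun ω => pos (X ω) :=
  measurable_euclidean fun i => by simp only [pos]; fun_prop

@[fun_prop]
lemma measurable_vel {X : Ω → State} (hX : Measurable X) : Measurable fun ω => vel (X ω) :=
  measurable_euclidean fun i => by simp only [vel]; fun_prop

@[fun_prop]
lemma measurable_motion (t : ℝ) {X : Ω → State} {u : Ω → Vec3} (hX : Measurable X)
    (hu : Measurable u) : Measurable fun ω => motion t (X ω) (u ω) :=
  ((LinearMap.continuous_of_finiteDimensional _).measurable.comp hX).add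
    ((LinearMap.continuous_of_finiteDimensional _).measurable.comp hu)

lemma measurable_shape (ρ : ℝ) (h : ℕ → ℝ) {r : Ω → ℝ} (k : ℕ) (hr : Measurable r) :
    Measurable fun ω => shape ρ h (r ω) k := by
  unfold shape
  fun_prop

lemma measurable_satur (β U : ℝ) {d₁ d₂ : Ω → ℝ} (h₁ : Measurable d₁) (h₂ : Measurable d₂) :
    Measurable fun ω => satur β U (d₁ ω) (d₂ ω) := by
  unfold satur
  fun_prop

lemma measurable_ctrlInput (t α s : ℝ) {g : Ω → ℝ} {X Xhat : Ω → State} {ζ ζ' : Ω → Vec3}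
    (hg : Measurable g) (hX : Measurable X) (hXhat : Measurable Xhat) (hζ : Measurable ζ)
    (hζ' : Measurable ζ') :
    Measurable fun ω => ctrlInput t α s (g ω) (X ω) (Xhat ω) (ζ ω) (ζ' ω) := by
  unfold ctrlInput
  fun_prop

lemma measurable_outRow {q : Ω → Vec3} (hq : Measurable q) (a : StateIdx) :
    Measurable fun ω => outRow (q ω) a := by
  rcases a with i | i <;> simp only [outRow, Sum.elim_inl, Sum.elim_inr] <;> fun_prop

lemma measurable_dotProduct {ι : Type*} [Fintype ι] {u v : Ω → ι → ℝ}
    (hu : ∀ i, Measurable fun ω => u ω i) (hv : ∀ i, Measurable fun ω => v ω i) :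
    Measurable fun ω => u ω ⬝ᵥ v ω :=
  Finset.measurable_sum _ fun i _ => (hu i).mul (hv i)

lemma measurable_mul_apply {l m n : Type*} [Fintype m] {A : Ω → Matrix l m ℝ}
    {B : Ω → Matrix m n ℝ} (hA : ∀ i j, Measurable fun ω => A ω i j)
    (hB : ∀ i j, Measurable fun ω => B ω i j) (i : l) (j : n) :
    Measurable fun ω => (A ω * B ω) i j :=
  measurable_dotProduct (hA i) fun a => hB a j

lemma measurable_predCov (t : ℝ) (W : Matrix (Fin 3) (Fin 3) ℝ)
    {G : Ω → Matrix StateIdx StateIdx ℝ} (hG : ∀ a b, Measurable fun ω => G ω a b)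
    (a b : StateIdx) : Measurable fun ω => predCov t W (G ω) a b := by
  have h1 := measurable_mul_apply (A := fun _ : Ω => matA t) (fun _ _ => measurable_const) hG
  have h2 := measurable_mul_apply h1 (B := fun _ : Ω => (matA t)ᵀ) (fun _ _ => measurable_const)
  exact (h2 a b).add_const _

lemma measurable_kalmanGain (Γ : ℝ) {H : Ω → Matrix StateIdx StateIdx ℝ}
    {C : Ω → StateIdx → ℝ} (hH : ∀ a b, Measurable fun ω => H ω a b)
    (hC : ∀ a, Measurable fun ω => C ω a) (a : StateIdx) :
    Measurable fun ω => kalmanGain Γ (H ω) (C ω) a := by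
  have h1 : ∀ a, Measurable fun ω => (H ω *ᵥ C ω) a := fun a => measurable_dotProduct (hH a) hC
  simp only [kalmanGain, Pi.smul_apply, smul_eq_mul]
  exact (((measurable_dotProduct hC h1).add_const _).inv).mul (h1 a)

lemma measurable_updCov {H : Ω → Matrix StateIdx StateIdx ℝ} {K C : Ω → StateIdx → ℝ}
    (hH : ∀ a b, Measurable fun ω => H ω a b) (hK : ∀ a, Measurable fun ω => K ω a)
    (hC : ∀ a, Measurable fun ω => C ω a) (a b : StateIdx) :
    Measurable fun ω => updCov (H ω) (K ω) (C ω) a b := by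
  refine measurable_mul_apply (fun i j => ?_) hH a b
  simp only [Matrix.sub_apply, vecMulVec_apply]
  exact measurable_const.sub ((hK i).mul (hC j))

end Measurability

namespace IsHostilePhase

variable {c : Params} {Ω : Type*} [mΩ : MeasurableSpace Ω] {P : Measure Ω}
  {ℱ : Filtration ℕ ‹MeasurableSpace Ω›} {τ : Ω → WithTop ℕ} {S : Processes Ω}

lemma measurable_T (h : IsHostilePhase c P ℱ τ S) : ∀ k, Measurable[ℱ k] (S.T k)
  | 0 => h.T_init
  | k + 1 => by
    have h1 : S.T (k + 1) = fun ω => motion c.t (S.T k ω) (S.a k ω) := funext (h.T_step k)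
    rw [h1]
    exact @measurable_motion _ (ℱ (k + 1)) _ _ _
      ((h.measurable_T k).mono (ℱ.mono k.le_succ) le_rfl) (h.a_meas k)

lemma measurable_ζ (h : IsHostilePhase c P ℱ τ S) (k : ℕ) : Measurable[ℱ k] (S.ζ c k) := by
  refine @measurable_shape _ (ℱ k) _ _ _ _ ?_
  cases k with
  | zero => exact h.r_init
  | succ k => exact (h.r_meas k).mono (ℱ.mono k.le_succ) le_rfl

lemma measurable_ζ_succ (h : IsHostilePhase c P ℱ τ S) (k : ℕ) :
    Measurable[ℱ k] (S.ζ c (k + 1)) :=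
  @measurable_shape _ (ℱ k) _ _ _ _ (h.r_meas k)

lemma measurable_outNoise (h : IsHostilePhase c P ℱ τ S) (k : ℕ) :
    Measurable[ℱ (k + 1)] (S.outNoise k) :=
  ((h.η_meas 1 k).sub (h.η_meas 0 k)).div_const 2

/-- Up to the stopping time the guardians and the filter agree with adapted processes. Nothing is
known about their measurability after the stopping time, where the controls are unrestricted. -/
lemma exists_adapted (h : IsHostilePhase c P ℱ τ S) (k : ℕ) :
    ∃ (X : Fin 2 → Ω → State) (Xhat : Ω → State) (G : Ω → Matrix StateIdx StateIdx ℝ),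
      (∀ i, Measurable[ℱ k] (X i)) ∧ Measurable[ℱ k] Xhat ∧
      (∀ a b, Measurable[ℱ k] fun ω => G ω a b) ∧
      ∀ ω, (k : WithTop ℕ) ≤ τ ω →
        (∀ i, S.X i k ω = X i ω) ∧ S.That k ω = Xhat ω ∧ S.G k ω = G ω := by
  induction k with
  | zero =>
    exact ⟨fun i => S.X i 0, S.That 0, S.G 0, h.X_init, h.That_init, h.G_init,
      fun ω _ => ⟨fun _ => rfl, rfl, rfl⟩⟩
  | succ k ih =>
    obtain ⟨X, Xhat, G, hX, hXhat, hG, hag⟩ := ih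
    have hle : ℱ k ≤ ℱ (k + 1) := ℱ.mono k.le_succ
    have hζ := h.measurable_ζ k
    have hζ' := h.measurable_ζ_succ k
    have hT := h.measurable_T (k + 1)
    have hn := h.measurable_outNoise k
    let g : Ω → ℝ := fun ω =>
      satur c.β c.U ‖pos (X 0 ω) - pos (Xhat ω)‖ ‖pos (X 1 ω) - pos (Xhat ω)‖
    let X' : Fin 2 → Ω → State := fun i ω => motion c.t (X i ω)
      (ctrlInput c.t c.α (guardSign i) (g ω) (X i ω) (Xhat ω) (S.ζ c k ω) (S.ζ c (k + 1) ω))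
    let q : Ω → Vec3 := fun ω => pos (X' 0 ω) - pos (X' 1 ω)
    let K : Ω → StateIdx → ℝ := fun ω =>
      kalmanGain c.outVar (predCov c.t c.accCov (G ω)) (outRow (q ω))
    let Xhat' : Ω → State := fun ω => Matrix.toEuclideanLin (matA c.t) (Xhat ω)
      + (outRow (q ω) ⬝ᵥ (S.T (k + 1) ω).ofLp + S.outNoise k ω
        - outRow (q ω) ⬝ᵥ (matA c.t).mulVec (Xhat ω).ofLp) • WithLp.toLp 2 (K ω)
    let G' : Ω → Matrix StateIdx StateIdx ℝ := fun ω =>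
      updCov (predCov c.t c.accCov (G ω)) (K ω) (outRow (q ω))
    have hag' : ∀ ω, ((k + 1 : ℕ) : WithTop ℕ) ≤ τ ω → (∀ i, S.X i (k + 1) ω = X' i ω) ∧
        S.That (k + 1) ω = Xhat' ω ∧ S.G (k + 1) ω = G' ω := by
      intro ω hω
      have hk : (k : WithTop ℕ) < τ ω := lt_of_lt_of_le (by exact_mod_cast k.lt_succ_self) hω
      obtain ⟨e1, e2, e3⟩ := hag ω hk.le
      have e4 : ∀ i, S.X i (k + 1) ω = X' i ω := by
        intro i
        rw [h.X_step, h.u_law i k ω hk, Processes.saturVal, e1, e1, e1, e2]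
      have e5 : S.q₁₂ (k + 1) ω = q ω := by
        rw [Processes.q₁₂, e4, e4]
      have e6 : S.gain c k ω = K ω := by
        rw [Processes.gain, Processes.Gpred, e3, e5]
      refine ⟨e4, ?_, ?_⟩
      · rw [h.That_step, S.output_eq, e5, e6, e2]
      · rw [h.G_step, e6, e5, Processes.Gpred, e3]
    have hg : Measurable[ℱ k] g := by
      let := ℱ k
      exact measurable_satur _ _ (by fun_prop) (by fun_prop)
    have hX' : ∀ i, Measurable[ℱ (k + 1)] (X' i) := by
      intro i
      refine Measurable.mono ?_ hle le_rfl
      exact @measurable_motion _ (ℱ k) _ _ _ (hX i)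
        (@measurable_ctrlInput _ (ℱ k) _ _ _ _ _ _ _ _ hg (hX i) hXhat hζ hζ')
    have hX0 := hX' 0
    have hX1 := hX' 1
    replace hG := fun a b => (hG a b).mono hle le_rfl
    replace hXhat := hXhat.mono hle le_rfl
    clear hle hζ hζ' hg hX
    -- from here on, measurability refers to the information at step `k + 1`
    let m' : MeasurableSpace Ω := ℱ (k + 1)
    have hq : Measurable q := by fun_prop
    have hC := measurable_outRow hq
    have hH := measurable_predCov c.t c.accCov hG
    have hK : ∀ a, Measurable fun ω => K ω a := measurable_kalmanGain c.outVar hH hC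
    refine ⟨X', Xhat', G', hX', ?_, measurable_updCov hH hK hC, hag'⟩
    refine Measurable.add
      ((LinearMap.continuous_of_finiteDimensional _).measurable.comp hXhat)
      (Measurable.smul (((measurable_dotProduct hC (by fun_prop)).add hn).sub
        (measurable_dotProduct hC fun a => ?_)) (measurable_euclidean hK))
    exact measurable_dotProduct (fun _ => measurable_const) (by fun_prop)

/-- Up to the stopping time, the errors and the saturation value agree with adapted processes. -/
lemma exists_adapted_err (h : IsHostilePhase c P ℱ τ S) (k : ℕ) :
    ∃ (e : Ω → State) (f : Ω → Vec3) (g : Ω → ℝ),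
      Measurable[ℱ k] e ∧ Measurable[ℱ k] f ∧ Measurable[ℱ k] g ∧
      ∀ ω, (k : WithTop ℕ) ≤ τ ω →
        S.estErr k ω = e ω ∧ S.encErr k ω = f ω ∧ S.saturVal c k ω = g ω := by
  obtain ⟨X, Xhat, _, hX, hXhat, _, hag⟩ := h.exists_adapted k
  have hT := h.measurable_T k
  have hX0 := hX 0
  have hX1 := hX 1
  have hag' : ∀ ω, (k : WithTop ℕ) ≤ τ ω → S.estErr k ω = S.T k ω - Xhat ω ∧
      S.encErr k ω = (pos (X 0 ω) - pos (S.T k ω)) + (pos (X 1 ω) - pos (S.T k ω)) ∧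
      S.saturVal c k ω
        = satur c.β c.U ‖pos (X 0 ω) - pos (Xhat ω)‖ ‖pos (X 1 ω) - pos (Xhat ω)‖ := by
    intro ω hω
    obtain ⟨e1, e2, -⟩ := hag ω hω
    simp only [Processes.estErr, Processes.encErr, Processes.saturVal, e1, e2]
    exact ⟨trivial, trivial, trivial⟩
  let m' : MeasurableSpace Ω := ℱ k
  exact ⟨_, _, _, by fun_prop, by fun_prop, measurable_satur _ _ (by fun_prop) (by fun_prop), hag'⟩

lemma measurableSet_le_stopping (h : IsHostilePhase c P ℱ τ S) (k : ℕ) :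
    MeasurableSet {ω | (k : WithTop ℕ) ≤ τ ω} :=
  ℱ.le k _ (h.stopping.measurableSet_ge_of_countable k)

lemma measurableSet_succ_le_stopping (h : IsHostilePhase c P ℱ τ S) (k : ℕ) :
    MeasurableSet[ℱ k] {ω | ((k + 1 : ℕ) : WithTop ℕ) ≤ τ ω} := by
  have h1 : {ω | ((k + 1 : ℕ) : WithTop ℕ) ≤ τ ω} = {ω | τ ω ≤ (k : WithTop ℕ)}ᶜ := by
    ext ω
    simp only [Set.mem_ofPred_eq, Set.mem_compl_iff, not_le]
    cases τ ω with
    | top => simp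
    | coe n => exact WithTop.coe_le_coe.trans (Nat.succ_le_iff.trans WithTop.coe_lt_coe.symm)
  rw [h1]
  exact (h.stopping k).compl

end IsHostilePhase

/-! ### Mean square of the estimation error -/

lemma norm_sq_eq_dotProduct {ι : Type*} [Fintype ι] (x : EuclideanSpace ℝ ι) :
    x.ofLp ⬝ᵥ x.ofLp = ‖x‖ ^ 2 := by
  rw [EuclideanSpace.real_norm_sq_eq]
  simp [dotProduct, sq]

section ErrBound

variable {Ω : Type*} [MeasurableSpace Ω] {P : Measure Ω} {θ C ν : ℝ} {N : ℕ → Ω → ℝ} {c₀ : Ω → ℝ}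

lemma integrable_errBound (hN : ∀ k, Integrable (N k) P) (hc₀ : Integrable c₀ P) :
    ∀ k, Integrable (fun ω => errBound θ C (fun m => N m ω) (c₀ ω) k) P
  | 0 => hc₀
  | k + 1 => ((integrable_errBound hN hc₀ k).add ((hN k).const_mul C)).const_mul θ

/-- In the mean, the majorant decays exponentially to the level set by the mean noise. -/
lemma integral_errBound_le (hθ : 0 ≤ θ) (hθ1 : θ < 1) (hC : 0 ≤ C)
    (hN : ∀ k, Integrable (N k) P) (hNν : ∀ k, ∫ ω, N k ω ∂P ≤ ν) (hν : 0 ≤ ν)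
    (hc₀ : Integrable c₀ P) (k : ℕ) :
    ∫ ω, errBound θ C (fun m => N m ω) (c₀ ω) k ∂P
      ≤ θ ^ k * ∫ ω, c₀ ω ∂P + θ * C * ν / (1 - θ) := by
  have hθ' : 0 < 1 - θ := by linarith
  induction k with
  | zero =>
    have : 0 ≤ θ * C * ν / (1 - θ) := by positivity
    simp only [errBound, pow_zero, one_mul]
    linarith
  | succ k ih =>
    simp only [errBound]
    rw [integral_const_mul, integral_add (integrable_errBound hN hc₀ k) ((hN k).const_mul C),
      integral_const_mul]
    have h1 := mul_le_mul_of_nonneg_left (hNν k) hC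
    calc _ ≤ θ * ((θ ^ k * ∫ ω, c₀ ω ∂P + θ * C * ν / (1 - θ)) + C * ν) := by gcongr
      _ = _ := by
        field_simp
        ring

end ErrBound

/-- The mean square estimation error decays exponentially to a constant level, as long as the
control law is in force. -/
theorem exists_integral_estErr_le.{u} {c : Params} (hc : c.Admissible) :
    ∃ κ θ b : ℝ, 0 < κ ∧ 0 < θ ∧ θ < 1 ∧ 0 < b ∧
      ∀ (Ω : Type u) [MeasurableSpace Ω] (P : Measure Ω) [IsProbabilityMeasure P]
        (ℱ : Filtration ℕ ‹MeasurableSpace Ω›) (τ : Ω → WithTop ℕ) (S : Processes Ω),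
        IsHostilePhase c P ℱ τ S → ∀ k : ℕ,
          IntegrableOn (fun ω => ‖S.estErr k ω‖ ^ 2) {ω | (k : WithTop ℕ) ≤ τ ω} P ∧
          ∫ ω in {ω | (k : WithTop ℕ) ≤ τ ω}, ‖S.estErr k ω‖ ^ 2 ∂P
            ≤ κ * θ ^ k * ∫ ω, ‖S.estErr 0 ω‖ ^ 2 ∂P + b := by
  have hN := hc.noiseBounds
  set wl := c.γ * c.wlo 0 + (1 - c.γ) * c.wlo 1 with hwl
  have hwl0 := hN.wl_pos
  have hwh0 : 0 < c.accCovUpper := hwl0.trans_le hN.wl_le_wh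
  have hΓ := hN.Γ_pos
  obtain ⟨g, θ, C, K, hg, hθ, hθ1, hC, hK, hbound⟩ := exists_errBound (r := c.rbar) c.R c.ghi c.N
    hc.abs_α_lt_one hc.contr_lt_one hc.alo_pos hc.t_pos hN hc.glo_pos
  have hθ' : 0 < 1 - θ := by linarith
  set ν := 3 * c.accCovUpper / wl + 2 with hν
  have hν0 : 0 < ν := by positivity
  refine ⟨g * K, θ, g * (θ * C * ν / (1 - θ)), by positivity, hθ, hθ1, by positivity, ?_⟩
  intro Ω _ P _ ℱ τ S h k
  set N : ℕ → Ω → ℝ := fun m ω => noiseSize c.outVar wl (S.a m ω).ofLp (S.outNoise m ω) with hNdef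
  have hNeq : ∀ m ω, N m ω = ‖S.a m ω‖ ^ 2 / wl + S.outNoise m ω ^ 2 / c.outVar := by
    intro m ω
    simp only [hNdef, noiseSize, norm_sq_eq_dotProduct]
  have ha : ∀ m, Integrable (fun ω => ‖S.a m ω‖ ^ 2) P := fun m =>
    (memLp_two_iff_integrable_sq_norm (h.measurable_a m).aestronglyMeasurable).1 (h.memLp_a m)
  have hn : ∀ m, Integrable (fun ω => S.outNoise m ω ^ 2) P := fun m =>
    (h.memLp_outNoise m).integrable_sq
  have hNint : ∀ m, Integrable (N m) P := by
    intro m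
    rw [funext (hNeq m)]
    exact ((ha m).div_const wl).add ((hn m).div_const c.outVar)
  have hNν : ∀ m, ∫ ω, N m ω ∂P ≤ ν := by
    intro m
    rw [funext (hNeq m), integral_add ((ha m).div_const wl) ((hn m).div_const c.outVar),
      integral_div, integral_div]
    refine add_le_add (div_le_div_of_nonneg_right (h.integral_sq_a_le hc m) hwl0.le) ?_
    rw [div_le_iff₀ hΓ]
    exact h.integral_sq_outNoise_le m
  have he0 : Integrable (fun ω => K * ‖S.estErr 0 ω‖ ^ 2) P :=
    ((memLp_two_iff_integrable_sq_norm h.estErr_init.1).1 h.estErr_init).const_mul K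
  set B : Ω → ℝ := fun ω => g * errBound θ C (fun m => N m ω) (K * ‖S.estErr 0 ω‖ ^ 2) k with hB
  have hBint : Integrable B P := (integrable_errBound hNint he0 k).const_mul g
  have hN0 : ∀ m ω, 0 ≤ N m ω := fun m ω => noiseSize_nonneg hΓ hwl0 _ _
  have hB0 : ∀ ω, 0 ≤ B ω := fun ω => mul_nonneg hg.le
    (errBound_nonneg hθ.le hC.le (fun m => hN0 m ω) (by positivity) k)
  have hpath : ∀ ω, (k : WithTop ℕ) ≤ τ ω → ‖S.estErr k ω‖ ^ 2 ≤ B ω := by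
    intro ω hω
    have h1 := hbound k (fun m => S.q₁₂ m ω) (fun m => S.ζ c m ω) (fun m => S.G m ω)
      (fun m => (S.estErr m ω).ofLp) (fun m => (S.a m ω).ofLp) (fun m => S.outNoise m ω)
      (h.isExcitedPath hc hω) (h.isCovPath hc ω) (fun m => h.estErr_step m ω) k le_rfl
    simpa only [norm_sq_eq_dotProduct] using h1
  have hA := h.measurableSet_le_stopping k
  obtain ⟨e, f, g', he, -, -, hag⟩ := h.exists_adapted_err k
  have hem : Measurable e := he.mono (ℱ.le k) le_rfl
  have hint : IntegrableOn (fun ω => ‖S.estErr k ω‖ ^ 2) {ω | (k : WithTop ℕ) ≤ τ ω} P := by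
    have h1 : IntegrableOn (fun ω => ‖e ω‖ ^ 2) {ω | (k : WithTop ℕ) ≤ τ ω} P := by
      refine Integrable.mono' hBint.integrableOn (by fun_prop) ?_
      filter_upwards [ae_restrict_mem hA] with ω hω
      rw [Real.norm_eq_abs, abs_of_nonneg (by positivity), ← (hag ω hω).1]
      exact hpath ω hω
    refine h1.congr_fun (fun ω hω => ?_) hA
    simp only [(hag ω hω).1]
  refine ⟨hint, ?_⟩
  calc ∫ ω in {ω | (k : WithTop ℕ) ≤ τ ω}, ‖S.estErr k ω‖ ^ 2 ∂P
      ≤ ∫ ω in {ω | (k : WithTop ℕ) ≤ τ ω}, B ω ∂P :=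
        setIntegral_mono_on hint hBint.integrableOn hA hpath
    _ ≤ ∫ ω, B ω ∂P := setIntegral_le_integral hBint (Filter.Eventually.of_forall hB0)
    _ ≤ g * (θ ^ k * ∫ ω, K * ‖S.estErr 0 ω‖ ^ 2 ∂P + θ * C * ν / (1 - θ)) := by
        rw [hB, integral_const_mul]
        gcongr
        exact integral_errBound_le hθ.le hθ1 hC.le hNint hNν hν0.le he0 k
    _ = _ := by
        rw [integral_const_mul]
        ring

/-! ### Mean square of the encirclement error -/

lemma norm_sq_pos_add_vel (x : State) : ‖pos x‖ ^ 2 + ‖vel x‖ ^ 2 = ‖x‖ ^ 2 := by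
  rw [← norm_sq_eq_dotProduct x, dotProduct_self_eq_norm]

/-- The part of the encirclement error that is known one step ahead, estimated by the errors. -/
lemma norm_sq_feedback_le {c : Params} (hc : c.Admissible) {ϱ : ℝ} (hϱ : 0 < ϱ) (d₁ d₂ : ℝ)
    (f : Vec3) (e : State) :
    ‖(1 + (c.α - 1) * satur c.β c.U d₁ d₂) • f
        + ((2 * ((c.α - 1) * satur c.β c.U d₁ d₂)) • pos e - (2 * c.t) • vel e)‖ ^ 2
      ≤ c.rate ϱ * ‖f‖ ^ 2
        + 4 * (1 + ϱ⁻¹) * ((1 - c.α) ^ 2 + c.t ^ 2) * ‖e‖ ^ 2 := by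
  have hl := hc.abs_feedback_le d₁ d₂
  have hcontr := hc.contr_pos
  have ht := hc.t_pos
  have hα : 0 < 1 - c.α := by linarith [hc.α_neg]
  obtain ⟨hg0, hg1⟩ := satur_mem hc.β_gt hc.U_pos d₁ d₂
  set g := satur c.β c.U d₁ d₂
  have hg : 0 ≤ g := (inv_nonneg.2 (zero_le_one.trans hc.β_gt.le)).trans hg0
  have h1 : ‖(1 + (c.α - 1) * g) • f‖ ≤ c.contr * ‖f‖ := by
    rw [norm_smul, Real.norm_eq_abs]
    gcongr
  have h2 : ‖(2 * ((c.α - 1) * g)) • pos e - (2 * c.t) • vel e‖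
      ≤ 2 * ((1 - c.α) * ‖pos e‖ + c.t * ‖vel e‖) := by
    refine (norm_sub_le _ _).trans ?_
    rw [norm_smul, norm_smul, Real.norm_eq_abs, Real.norm_eq_abs,
      abs_of_pos (show 0 < 2 * c.t by positivity)]
    have h3 : |2 * ((c.α - 1) * g)| ≤ 2 * (1 - c.α) := by
      rw [abs_le]
      constructor <;> nlinarith
    have := mul_le_mul_of_nonneg_right h3 (norm_nonneg (pos e))
    linarith
  set x := ‖(1 + (c.α - 1) * g) • f‖ with hx
  set y := ‖(2 * ((c.α - 1) * g)) • pos e - (2 * c.t) • vel e‖ with hy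
  have hx0 : 0 ≤ x := norm_nonneg _
  have hy0 : 0 ≤ y := norm_nonneg _
  have h4 : (x + y) ^ 2 ≤ (1 + ϱ) * x ^ 2 + (1 + ϱ⁻¹) * y ^ 2 := by
    have h5 : (1 + ϱ) * x ^ 2 + (1 + ϱ⁻¹) * y ^ 2 - (x + y) ^ 2 = ϱ⁻¹ * (ϱ * x - y) ^ 2 := by
      field_simp
      ring
    have h6 : 0 ≤ ϱ⁻¹ * (ϱ * x - y) ^ 2 := by positivity
    linarith
  have h7 : x ^ 2 ≤ c.contr ^ 2 * ‖f‖ ^ 2 := by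
    rw [← mul_pow]
    gcongr
  have h8 : y ^ 2 ≤ 4 * (((1 - c.α) ^ 2 + c.t ^ 2) * ‖e‖ ^ 2) := by
    have h9 : y ^ 2 ≤ (2 * ((1 - c.α) * ‖pos e‖ + c.t * ‖vel e‖)) ^ 2 := by gcongr
    rw [← norm_sq_pos_add_vel]
    nlinarith [sq_nonneg ((1 - c.α) * ‖vel e‖ - c.t * ‖pos e‖)]
  have hi : 0 < ϱ⁻¹ := by positivity
  calc _ ≤ (x + y) ^ 2 := by
        gcongr
        exact norm_add_le _ _
    _ ≤ (1 + ϱ) * x ^ 2 + (1 + ϱ⁻¹) * y ^ 2 := h4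
    _ ≤ (1 + ϱ) * (c.contr ^ 2 * ‖f‖ ^ 2)
        + (1 + ϱ⁻¹) * (4 * (((1 - c.α) ^ 2 + c.t ^ 2) * ‖e‖ ^ 2)) := by gcongr
    _ = _ := by
      rw [Params.rate]
      ring

namespace IsHostilePhase

variable {c : Params} {Ω : Type*} [mΩ : MeasurableSpace Ω] {P : Measure Ω}
  {ℱ : Filtration ℕ ‹MeasurableSpace Ω›} {τ : Ω → WithTop ℕ} {S : Processes Ω}

/-- The recursion of the mean square encirclement error. The acceleration of the target contributes
only its variance, since it is uncorrelated with the errors of the previous step. -/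
lemma integral_encErr_succ_le [IsProbabilityMeasure P] (h : IsHostilePhase c P ℱ τ S)
    (hc : c.Admissible) {ϱ : ℝ} (hϱ : 0 < ϱ) (k : ℕ)
    (he : IntegrableOn (fun ω => ‖S.estErr k ω‖ ^ 2) {ω | (k : WithTop ℕ) ≤ τ ω} P)
    (hf : IntegrableOn (fun ω => ‖S.encErr k ω‖ ^ 2) {ω | (k : WithTop ℕ) ≤ τ ω} P) :
    IntegrableOn (fun ω => ‖S.encErr (k + 1) ω‖ ^ 2) {ω | ((k + 1 : ℕ) : WithTop ℕ) ≤ τ ω} P ∧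
      ∫ ω in {ω | ((k + 1 : ℕ) : WithTop ℕ) ≤ τ ω}, ‖S.encErr (k + 1) ω‖ ^ 2 ∂P
        ≤ c.rate ϱ * ∫ ω in {ω | (k : WithTop ℕ) ≤ τ ω}, ‖S.encErr k ω‖ ^ 2 ∂P
          + c.forcing ϱ (∫ ω in {ω | (k : WithTop ℕ) ≤ τ ω}, ‖S.estErr k ω‖ ^ 2 ∂P) := by
  set A₀ := {ω | (k : WithTop ℕ) ≤ τ ω} with hA₀
  set A := {ω | ((k + 1 : ℕ) : WithTop ℕ) ≤ τ ω} with hA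
  have hlt : ∀ ω ∈ A, (k : WithTop ℕ) < τ ω := fun ω hω =>
    lt_of_lt_of_le (by exact_mod_cast k.lt_succ_self) hω
  have hAA₀ : A ⊆ A₀ := fun ω hω => (hlt ω hω).le
  have hAk : MeasurableSet[ℱ k] A := h.measurableSet_succ_le_stopping k
  have hAm : MeasurableSet A := ℱ.le k _ hAk
  have hA₀m : MeasurableSet A₀ := h.measurableSet_le_stopping k
  obtain ⟨e, f, g, hem, hfm, hgm, hag⟩ := h.exists_adapted_err k
  -- the part of the error at step `k + 1` that is known at step `k`, cut off at the stopping time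
  set M : Ω → Vec3 := A.indicator fun ω => (1 + (c.α - 1) * g ω) • f ω
    + ((2 * ((c.α - 1) * g ω)) • pos (e ω) - (2 * c.t) • vel (e ω)) with hM
  have hMk : Measurable[ℱ k] M := by
    let m' : MeasurableSpace Ω := ℱ k
    exact Measurable.indicator (by fun_prop) hAk
  have hMm : Measurable M := hMk.mono (ℱ.le k) le_rfl
  have hstep : ∀ ω ∈ A, S.encErr (k + 1) ω = M ω - (c.t ^ 2) • S.a k ω := by
    intro ω hω
    obtain ⟨e1, e2, e3⟩ := hag ω (hAA₀ hω)
    rw [h.encErr_step hc (hlt ω hω), e1, e2, e3, hM, Set.indicator_of_mem hω]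
  set D := 4 * (1 + ϱ⁻¹) * ((1 - c.α) ^ 2 + c.t ^ 2) with hD
  have hMle : ∀ ω ∈ A, ‖M ω‖ ^ 2 ≤ c.rate ϱ * ‖S.encErr k ω‖ ^ 2 + D * ‖S.estErr k ω‖ ^ 2 := by
    intro ω hω
    obtain ⟨e1, e2, e3⟩ := hag ω (hAA₀ hω)
    rw [hM, Set.indicator_of_mem hω, ← e1, ← e2, ← e3]
    exact norm_sq_feedback_le hc hϱ _ _ _ _
  have hrate : 0 ≤ c.rate ϱ := by
    unfold Params.rate
    positivity
  have hD0 : 0 ≤ D := by positivity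
  have hbd : IntegrableOn
      (fun ω => c.rate ϱ * ‖S.encErr k ω‖ ^ 2 + D * ‖S.estErr k ω‖ ^ 2) A₀ P :=
    (hf.const_mul _).add (he.const_mul _)
  have hMle' : ∀ ω, ‖M ω‖ ^ 2 ≤ A₀.indicator
      (fun ω => c.rate ϱ * ‖S.encErr k ω‖ ^ 2 + D * ‖S.estErr k ω‖ ^ 2) ω := by
    intro ω
    by_cases hω : ω ∈ A
    · rw [Set.indicator_of_mem (hAA₀ hω)]
      exact hMle ω hω
    · have h0 : M ω = 0 := Set.indicator_of_notMem hω _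
      rw [h0, norm_zero, zero_pow two_ne_zero]
      exact Set.indicator_nonneg (fun _ _ => by positivity) ω
  have hMint : Integrable (fun ω => ‖M ω‖ ^ 2) P := by
    refine Integrable.mono' (hbd.integrable_indicator hA₀m) (by fun_prop)
      (Filter.Eventually.of_forall fun ω => ?_)
    rw [Real.norm_eq_abs, abs_of_nonneg (by positivity)]
    exact hMle' ω
  have hMb : ∫ ω, ‖M ω‖ ^ 2 ∂P ≤ c.rate ϱ * ∫ ω in A₀, ‖S.encErr k ω‖ ^ 2 ∂P
      + D * ∫ ω in A₀, ‖S.estErr k ω‖ ^ 2 ∂P := by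
    refine (integral_mono hMint (hbd.integrable_indicator hA₀m) hMle').trans_eq ?_
    rw [integral_indicator hA₀m, integral_add (hf.const_mul _) (he.const_mul _),
      integral_const_mul, integral_const_mul]
  have hMi : Integrable M P :=
    ((memLp_two_iff_integrable_sq_norm hMm.aestronglyMeasurable).2 hMint).integrable one_le_two
  obtain ⟨hcross, hcross0⟩ := h.integral_inner_a k hMk hMi
  have ha : Integrable (fun ω => ‖S.a k ω‖ ^ 2) P :=
    (memLp_two_iff_integrable_sq_norm (h.measurable_a k).aestronglyMeasurable).1 (h.memLp_a k)
  have hexp : ∀ ω, ‖M ω - (c.t ^ 2) • S.a k ω‖ ^ 2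
      = ‖M ω‖ ^ 2 - 2 * c.t ^ 2 * inner ℝ (M ω) (S.a k ω) + c.t ^ 4 * ‖S.a k ω‖ ^ 2 := by
    intro ω
    rw [norm_sub_sq_real, real_inner_smul_right, norm_smul, mul_pow, Real.norm_eq_abs, sq_abs]
    ring
  have hint₁ : Integrable
      (fun ω => ‖M ω‖ ^ 2 - 2 * c.t ^ 2 * inner ℝ (M ω) (S.a k ω)) P :=
    hMint.sub (hcross.const_mul (2 * c.t ^ 2))
  have hint₂ := ha.const_mul (c.t ^ 4)
  have hint : Integrable (fun ω => ‖M ω - (c.t ^ 2) • S.a k ω‖ ^ 2) P := by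
    rw [funext hexp]
    exact hint₁.add hint₂
  have heq : Set.EqOn (fun ω => ‖M ω - (c.t ^ 2) • S.a k ω‖ ^ 2)
      (fun ω => ‖S.encErr (k + 1) ω‖ ^ 2) A := fun ω hω => by
    simp only [hstep ω hω]
  refine ⟨hint.integrableOn.congr_fun heq hAm, ?_⟩
  calc ∫ ω in A, ‖S.encErr (k + 1) ω‖ ^ 2 ∂P
      = ∫ ω in A, ‖M ω - (c.t ^ 2) • S.a k ω‖ ^ 2 ∂P := (setIntegral_congr_fun hAm heq).symm
    _ ≤ ∫ ω, ‖M ω - (c.t ^ 2) • S.a k ω‖ ^ 2 ∂P :=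
        setIntegral_le_integral hint (Filter.Eventually.of_forall fun ω => by positivity)
    _ = ∫ ω, ‖M ω‖ ^ 2 ∂P + c.t ^ 4 * ∫ ω, ‖S.a k ω‖ ^ 2 ∂P := by
        rw [funext hexp, integral_add hint₁ hint₂, integral_sub hMint (hcross.const_mul _),
          integral_const_mul, integral_const_mul, hcross0, mul_zero, sub_zero]
    _ ≤ (c.rate ϱ * ∫ ω in A₀, ‖S.encErr k ω‖ ^ 2 ∂P
          + D * ∫ ω in A₀, ‖S.estErr k ω‖ ^ 2 ∂P) + c.t ^ 4 * (3 * c.accCovUpper) := by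
        have := h.integral_sq_a_le hc k
        gcongr
    _ = _ := by
        rw [Params.forcing, hD]
        ring

end IsHostilePhase

/-! ### Scalar recursions -/

lemma le_geometric_sum {m : ℕ → ℝ} {r f : ℝ} (hr : 0 ≤ r) (hm : ∀ k, m (k + 1) ≤ r * m k + f)
    (k : ℕ) : m k ≤ r ^ k * m 0 + ∑ i ∈ Finset.range k, r ^ i * f := by
  induction k with
  | zero => simp
  | succ k ih =>
    refine (hm k).trans ((add_le_add_left (mul_le_mul_of_nonneg_left ih hr) f).trans_eq ?_)
    rw [Finset.sum_range_succ', mul_add, Finset.mul_sum]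
    simp only [pow_succ]
    ring_nf

/-- A linear recursion with rate `r < 1` whose forcing decays like `θ ^ k` to a constant level. -/
lemma le_geometric_add_level {m : ℕ → ℝ} {r θ a f x y D ν : ℝ} (hr : 0 ≤ r) (hr1 : r < 1)
    (hθ : 0 ≤ θ) (ha : 0 ≤ a) (hf : 0 ≤ f) (hx : 0 ≤ x) (hy : 0 ≤ y) (hθν : θ ≤ ν)
    (hD1 : 1 ≤ D) (hD : a ≤ D * (ν - r)) (hm0 : m 0 ≤ x)
    (hm : ∀ k, m (k + 1) ≤ r * m k + (a * θ ^ k * y + f)) (k : ℕ) :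
    m k ≤ D * ν ^ k * (x + y) + f / (1 - r) := by
  have hr' : 0 < 1 - r := by linarith
  induction k with
  | zero =>
    have : 0 ≤ f / (1 - r) := by positivity
    rw [pow_zero, mul_one]
    nlinarith
  | succ k ih =>
    have h1 : a * θ ^ k * y ≤ a * ν ^ k * (x + y) := by
      have hν : 0 ≤ ν := hθ.trans hθν
      gcongr
      linarith
    have h2 : a * (ν ^ k * (x + y)) ≤ D * (ν - r) * (ν ^ k * (x + y)) := by
      have hν : 0 ≤ ν := hθ.trans hθν
      gcongr
    calc m (k + 1) ≤ r * (D * ν ^ k * (x + y) + f / (1 - r)) + (a * ν ^ k * (x + y) + f) :=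
          (hm k).trans (by gcongr)
      _ ≤ r * (D * ν ^ k * (x + y)) + D * (ν - r) * (ν ^ k * (x + y))
          + (r * (f / (1 - r)) + f) := by linarith
      _ = _ := by
        field_simp
        ring

lemma Params.Admissible.rate_lt_one {c : Params} (hc : c.Admissible) {ϱ : ℝ} (hϱ : 0 < ϱ)
    (h₁ : c.β < √(1 + ϱ) / (√(1 + ϱ) - 1)) (h₂ : √(1 + ϱ) < c.β) : c.rate ϱ < 1 := by
  have hβ : 0 < c.β := zero_lt_one.trans hc.β_gt
  set s := √(1 + ϱ) with hs
  have hs1 : 1 < s := by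
    rw [hs, Real.lt_sqrt zero_le_one]
    linarith
  have hs0 : 0 < s := zero_lt_one.trans hs1
  have hsq : s ^ 2 = 1 + ϱ := Real.sq_sqrt (by linarith)
  have h3 : s * c.contr < 1 := by
    rw [← lt_div_iff₀' hs0]
    refine max_lt ?_ ?_
    · rw [one_div]
      exact (inv_lt_inv₀ hβ hs0).2 h₂
    · rw [lt_div_iff₀ (by linarith)] at h₁
      rw [inv_eq_one_div, sub_lt_iff_lt_add, div_add_div _ _ hs0.ne' hβ.ne',
        lt_div_iff₀ (by positivity)]
      linarith
  rw [Params.rate, ← hsq, ← mul_pow]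
  have := mul_pos hs0 hc.contr_pos
  nlinarith

end Encirclement

end

theorem theorem3 (c : Encirclement.Params) (hc : c.Admissible) :
    ∃ κ θ b : ℝ, 0 < κ ∧ 0 < θ ∧ θ < 1 ∧ 0 < b ∧
      ∀ ϱ : ℝ, 0 < ϱ → ϱ < 1 → c.β < √(1 + ϱ) / (√(1 + ϱ) - 1) → √(1 + ϱ) < c.β →
        c.rate ϱ < 1 ∧
        ∃ D ν : ℝ, 0 < D ∧ 0 < ν ∧ ν < 1 ∧
          ∀ (Ω : Type*) [MeasurableSpace Ω] (P : Measure Ω) [IsProbabilityMeasure P]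
            (ℱ : Filtration ℕ ‹MeasurableSpace Ω›) (τ : Ω → WithTop ℕ)
            (S : Encirclement.Processes Ω),
            Encirclement.IsHostilePhase c P ℱ τ S → ∀ k : ℕ,
              -- mean square estimation error
              (IntegrableOn (fun ω => ‖S.estErr k ω‖ ^ 2) {ω | (k : WithTop ℕ) ≤ τ ω} P ∧
                ∫ ω in {ω | (k : WithTop ℕ) ≤ τ ω}, ‖S.estErr k ω‖ ^ 2 ∂P
                  ≤ κ * θ ^ k * ∫ ω, ‖S.estErr 0 ω‖ ^ 2 ∂P + b) ∧
              -- mean square encirclement error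
              IntegrableOn (fun ω => ‖S.encErr k ω‖ ^ 2) {ω | (k : WithTop ℕ) ≤ τ ω} P ∧
              ∫ ω in {ω | (k : WithTop ℕ) ≤ τ ω}, ‖S.encErr k ω‖ ^ 2 ∂P
                ≤ c.rate ϱ ^ k * ∫ ω, ‖S.encErr 0 ω‖ ^ 2 ∂P
                  + ∑ i ∈ Finset.range k, c.rate ϱ ^ i
                    * c.forcing ϱ (κ * ∫ ω, ‖S.estErr 0 ω‖ ^ 2 ∂P + b) ∧
              ∫ ω in {ω | (k : WithTop ℕ) ≤ τ ω}, ‖S.encErr k ω‖ ^ 2 ∂P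
                ≤ D * ν ^ k * (∫ ω, ‖S.encErr 0 ω‖ ^ 2 ∂P + ∫ ω, ‖S.estErr 0 ω‖ ^ 2 ∂P)
                  + c.forcing ϱ b / (1 - c.rate ϱ) := by
  obtain ⟨κ, θ, b, hκ, hθ, hθ1, hb, hest⟩ := Encirclement.exists_integral_estErr_le hc
  refine ⟨κ, θ, b, hκ, hθ, hθ1, hb, fun ϱ hϱ _ hβ₁ hβ₂ => ?_⟩
  have hrate := hc.rate_lt_one hϱ hβ₁ hβ₂
  have hrate0 : 0 < c.rate ϱ := by
    have := hc.contr_pos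
    unfold Encirclement.Params.rate
    positivity
  have hi : 0 < ϱ⁻¹ := inv_pos.2 hϱ
  have ht := hc.t_pos
  have hwh : 0 < c.accCovUpper := hc.noiseBounds.wl_pos.trans_le hc.noiseBounds.wl_le_wh
  set a := 4 * (1 + ϱ⁻¹) * ((1 - c.α) ^ 2 + c.t ^ 2) with ha
  have ha0 : 0 < a := by positivity
  have hforcing : ∀ ε, c.forcing ϱ ε = a * ε + 3 * c.t ^ 4 * c.accCovUpper := fun ε => rfl
  have hmono : ∀ {ε ε' : ℝ}, ε ≤ ε' → c.forcing ϱ ε ≤ c.forcing ϱ ε' := by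
    intro ε ε' h
    rw [hforcing, hforcing]
    gcongr
  -- `ν` is any rate strictly between the two decay rates and `1`
  obtain ⟨ν, hν, hν1⟩ := exists_between (max_lt hrate hθ1)
  have hrν : c.rate ϱ < ν := (le_max_left _ _).trans_lt hν
  have hθν : θ < ν := (le_max_right _ _).trans_lt hν
  have hrν' : 0 < ν - c.rate ϱ := by linarith
  refine ⟨hrate, 1 + a * κ / (ν - c.rate ϱ), ν, by positivity, hrate0.trans hrν, hν1, ?_⟩
  intro Ω _ P _ ℱ τ S h
  have hE := hest Ω P ℱ τ S h
  have hx : 0 ≤ ∫ ω, ‖S.encErr 0 ω‖ ^ 2 ∂P := integral_nonneg fun ω => by positivity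
  have hy : 0 ≤ ∫ ω, ‖S.estErr 0 ω‖ ^ 2 ∂P := integral_nonneg fun ω => by positivity
  have huniv : {ω | ((0 : ℕ) : WithTop ℕ) ≤ τ ω} = Set.univ :=
    Set.eq_univ_of_forall fun ω => by simp
  have hF : ∀ k : ℕ,
      IntegrableOn (fun ω => ‖S.encErr k ω‖ ^ 2) {ω | (k : WithTop ℕ) ≤ τ ω} P := by
    intro k
    induction k with
    | zero =>
      exact ((memLp_two_iff_integrable_sq_norm h.encErr_init.1).1 h.encErr_init).integrableOn
    | succ k ih => exact (h.integral_encErr_succ_le hc hϱ k (hE k).1 ih).1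
  have hrec := fun k => (h.integral_encErr_succ_le hc hϱ k (hE k).1 (hF k)).2
  have hinit : ∫ ω in {ω | ((0 : ℕ) : WithTop ℕ) ≤ τ ω}, ‖S.encErr 0 ω‖ ^ 2 ∂P
      = ∫ ω, ‖S.encErr 0 ω‖ ^ 2 ∂P := by
    rw [huniv, setIntegral_univ]
  intro k
  refine ⟨hE k, hF k, ?_, ?_⟩
  · rw [← hinit]
    refine Encirclement.le_geometric_sum hrate0.le
      (m := fun k : ℕ => ∫ ω in {ω | (k : WithTop ℕ) ≤ τ ω}, ‖S.encErr k ω‖ ^ 2 ∂P) ?_ k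
    intro j
    refine (hrec j).trans (add_le_add le_rfl (hmono ((hE j).2.trans ?_)))
    have h1 : θ ^ j ≤ 1 := pow_le_one₀ hθ.le hθ1.le
    have h2 : κ * θ ^ j ≤ κ := mul_le_of_le_one_right hκ.le h1
    gcongr
  · refine Encirclement.le_geometric_add_level hrate0.le hrate hθ.le (a := a * κ)
      (m := fun k : ℕ => ∫ ω in {ω | (k : WithTop ℕ) ≤ τ ω}, ‖S.encErr k ω‖ ^ 2 ∂P)
      (by positivity) ?_ hx hy hθν.le ?_ ?_ hinit.le ?_ k
    · rw [hforcing]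
      positivity
    · have : 0 ≤ a * κ / (ν - c.rate ϱ) := by positivity
      linarith
    · rw [add_mul, div_mul_cancel₀ _ hrν'.ne']
      linarith
    · intro j
      refine (hrec j).trans (add_le_add le_rfl ((hmono (hE j).2).trans_eq ?_))
      rw [hforcing, hforcing]
      ring
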